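/- \textbf{Setting.} An acyclic directed mixed graph (ADMG) $\mathcal{G}$ has a finite vertex set $V$, directed edges $v\to w$ without directed cycles, and bidirected edges $v\leftrightarrow w$ between distinct vertices; both kinds of edge may join the same two vertices. Let $\mathrm{pa}(W)$ be the set of parents of vertices in $W$ and $\mathrm{an}(W)$ the set of vertices from which there is a possibly empty directed path to some vertex of $W$. For $W\subseteq A\subseteq V$ let $\mathrm{dis}_A(W)$ be the set of vertices joined to some vertex of $W$ by a possibly empty path of bidirected edges inside $A$. A path is a sequence of adjacent edges without repetition of a vertex. A non-endpoint of a path is a \emph{collider} if both adjacent edges of the path have an arrowhead at it, and a \emph{non-collider} otherwise. A path is \emph{blocked} by $C$ if some non-collider on it lies in $C$ or some collider on it is not in $\mathrm{an}(C)$. Disjoint sets $A,B$ are \emph{m-separated} given $C$ (disjoint from $A\cup B$) if every path from a vertex of $A$ to a vertex of $B$ is blocked by $C$. A distribution $P$ of a binary random vector $X_V\in\{0,1\}^V$ obeys the \emph{global Markov property} for $\mathcal{G}$ if, for all disjoint $A,B,C\subseteq V$ with $A,B\neq\emptyset$, m-separation of $A$ and $B$ given $C$ implies that $X_A$ is independent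 of $X_B$ conditionally on $X_C$. Let $\mathcal{P}_{\mathcal{G}}$ be the set of strictly positive probability distributions on $\{0,1\}^V$ that obey the global Markov property for $\mathcal{G}$. A \emph{head} is a non-empty set $H\subseteq V$ such that no vertex of $H$ has a descendant in $H$ other than itself, and $H$ is contained in a single district (bidirected-connected component) of the subgraph induced on $\mathrm{an}(H)$. Its \emph{tail} is \[ T=\mathrm{tail}(H)=\bigl(\mathrm{dis}_{\mathrm{an}(H)}(H)\setminus H\bigr)\cup \mathrm{pa}\bigl(\mathrm{dis}_{\mathrm{an}(H)}(H)\bigr). \] For distinct heads write $H_1\prec H_2$ if $H_1\subseteq \mathrm{an}(H_2)$. For $W\subseteq V$ let $\Phi(W)$ be the set of heads contained in $W$ that are $\prec$-maximal among the heads contained in $W$, let $\psi(W)=W\setminus\bigcup_{H\in\Phi(W)}H$, and define recursively $[\emptyset]_{\mathcal{G}}=\emptyset$ and $[W]_{\mathcal{G}}=\Phi(W)\cup[\psi(W)]_{\mathcal{G}}$ for $W\ne\emptyset$. For $P\in\mathcal{P}_{\mathcal{G}}$ let $\boldsymbol q(P)$ be the real vector, indexed by all pairs $(H,x_T)$ where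 $H$ is a head with tail $T$ and $x_T\in\{0,1\}^T$, with entries $q_H(x_T)=P(X_H=0\mid X_T=x_T)$. Let $\mathcal{Q}_{\mathcal{G}}=\boldsymbol q(\mathcal{P}_{\mathcal{G}})$ be the image of $\mathcal{P}_{\mathcal{G}}$ under this map; its elements are called \emph{valid}. \textbf{Theorem.} Let $\mathcal{G}$ be an ADMG with vertex set $V$. A real vector $\boldsymbol q=(q_H(x_T))$, indexed by the heads $H$ of $\mathcal{G}$ and $x_T\in\{0,1\}^{\mathrm{tail}(H)}$, is valid (that is, $\boldsymbol q\in\mathcal{Q}_{\mathcal{G}}$) if and only if for each $x_V\in\{0,1\}^V$ \[ p_{x_V}(\boldsymbol q)\equiv\sum_{C\,:\,x_V^{-1}(0)\subseteq C\subseteq V}(-1)^{|C\setminus x_V^{-1}(0)|}\prod_{H\in[C]_{\mathcal{G}}}q_H(x_T)>0, \] where $x_V^{-1}(0)=\{v\in V : x_v=0\}$, $x_T$ is the restriction of $x_V$ to $T=\mathrm{tail}(H)$, and empty products equal $1$. -/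

import Mathlib

/-- An acyclic directed mixed graph on `V`: directed edges `dir v w` (`v → w`) without directed
cycles, and bidirected edges `bi v w` (`v ↔ w`), which are unordered pairs of distinct vertices.
Both kinds of edge may be present between the same two vertices. -/
structure ADMG (V : Type*) where
  dir : V → V → Prop
  bi : V → V → Prop
  acyclic : ∀ v, ¬ Relation.TransGen dir v v
  bi_symm : ∀ v w, bi v w → bi w v
  bi_irrefl : ∀ v, ¬ bi v v

/-- The three ways of traversing an edge from a vertex `u` to a vertex `v`:
`u → v`, `u ← v` and `u ↔ v`. -/
inductive EdgeKind where
  | fwd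
  | bwd
  | bidir

namespace EdgeKind

/-- The traversed edge has an arrowhead at the vertex where the traversal starts. -/
def headAtSource : EdgeKind → Prop
  | fwd => False
  | bwd => True
  | bidir => True

/-- The traversed edge has an arrowhead at the vertex where the traversal ends. -/
def headAtTarget : EdgeKind → Prop
  | fwd => True
  | bwd => False
  | bidir => True

end EdgeKind

namespace ADMG

section Graph

variable {V : Type*}

/-- `w` is an ancestor of `v` (equivalently, `v` is a descendant of `w`): there is a possibly
empty directed path from `w` to `v`. -/
def IsAncestor (G : ADMG V) (w v : V) : Prop := Relation.ReflTransGen G.dir w v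

theorem IsAncestor.antisymm {G : ADMG V} {v w : V} (h : G.IsAncestor v w)
    (h' : G.IsAncestor w v) : v = w := by
  rcases Relation.reflTransGen_iff_eq_or_transGen.1 h with h1 | h1
  · exact h1.symm
  · exact absurd (h1.trans_left h') (G.acyclic v)

/-- `G.Edge k u v`: the graph has an edge of kind `k` between `u` and `v`, seen from `u`. -/
def Edge (G : ADMG V) : EdgeKind → V → V → Prop
  | .fwd, u, v => G.dir u v
  | .bwd, u, v => G.dir v u
  | .bidir, u, v => G.bi u v

/-- Sequences of adjacent edges; a path is a walk without repeated vertices. -/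
inductive Walk (G : ADMG V) : V → V → Type _ where
  | nil (u : V) : Walk G u u
  | cons {u v w : V} (k : EdgeKind) (e : G.Edge k u v) (p : Walk G v w) : Walk G u w

namespace Walk

variable {G : ADMG V}

/-- The list of vertices visited. -/
def support : {u w : V} → G.Walk u w → List V
  | _, _, .nil u => [u]
  | u, _, .cons _ _ p => u :: p.support

/-- A path is a sequence of adjacent edges without repetition of a vertex. -/
def IsPath {u w : V} (p : G.Walk u w) : Prop := p.support.Nodup

/-- `c` is a non-endpoint of the path such that both the preceding and the succeeding edge
have an arrowhead at `c`. -/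
def IsCollider : {u w : V} → G.Walk u w → V → Prop
  | _, _, .nil _, _ => False
  | _, _, .cons _ _ (.nil _), _ => False
  | _, _, .cons k _ (.cons (u := v) k' e' p), c =>
      (c = v ∧ (k.headAtTarget ∧ k'.headAtSource)) ∨ IsCollider (.cons k' e' p) c

/-- `c` is a non-endpoint of the path which is not a collider. -/
def IsNonCollider : {u w : V} → G.Walk u w → V → Prop
  | _, _, .nil _, _ => False
  | _, _, .cons _ _ (.nil _), _ => False
  | _, _, .cons k _ (.cons (u := v) k' e' p), c =>
      (c = v ∧ ¬ (k.headAtTarget ∧ k'.headAtSource)) ∨ IsNonCollider (.cons k' e' p) c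

/-- The path is blocked by `C`: some non-collider on it lies in `C`, or some collider on it is
not an ancestor of a member of `C`. -/
def Blocked {u w : V} (p : G.Walk u w) (C : Finset V) : Prop :=
  (∃ c, p.IsNonCollider c ∧ c ∈ C) ∨
    (∃ c, p.IsCollider c ∧ ¬ ∃ d ∈ C, G.IsAncestor c d)

end Walk

/-- `A` and `B` are m-separated given `C`: every path between a vertex of `A` and a vertex of `B`
is blocked by `C`. (Only used for pairwise disjoint `A`, `B`, `C`.) -/
def MSeparated (G : ADMG V) (A B C : Finset V) : Prop :=
  ∀ a ∈ A, ∀ b ∈ B, ∀ p : G.Walk a b, p.IsPath → p.Blocked C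

end Graph

section Heads

variable {V : Type*} [Fintype V] [DecidableEq V]

open Classical in
/-- The ancestors of the members of `W` (including `W` itself). -/
noncomputable def an (G : ADMG V) (W : Finset V) : Finset V :=
  Finset.univ.filter fun w => ∃ v ∈ W, G.IsAncestor w v

open Classical in
/-- The descendants of `v` (including `v` itself). -/
noncomputable def de (G : ADMG V) (v : V) : Finset V :=
  Finset.univ.filter fun w => G.IsAncestor v w

open Classical in
/-- The parents of the members of `W`. -/
noncomputable def pa (G : ADMG V) (W : Finset V) : Finset V :=
  Finset.univ.filter fun w => ∃ v ∈ W, G.dir w v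

open Classical in
/-- `G.dis A W` is the union of the districts of the vertices `v ∈ W` in the induced subgraph of
`G` on `A`: all `w ∈ A` joined to some `v ∈ W` by a possibly empty sequence of bidirected edges
between vertices of `A`. (Only used for `W ⊆ A`.) -/
noncomputable def dis (G : ADMG V) (A W : Finset V) : Finset V :=
  A.filter fun w => ∃ v ∈ W, Relation.ReflTransGen (fun a b => a ∈ A ∧ b ∈ A ∧ G.bi a b) v w

/-- `B` is barren: no vertex of `B` has a descendant in `B` other than itself. -/
def IsBarren (G : ADMG V) (B : Finset V) : Prop := ∀ v ∈ B, G.de v ∩ B = {v}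

/-- A head is a non-empty barren set contained in a single district of the induced subgraph on
its ancestors. -/
def IsHead (G : ADMG V) (H : Finset V) : Prop :=
  H.Nonempty ∧ G.IsBarren H ∧ ∃ v ∈ G.an H, H ⊆ G.dis (G.an H) {v}

/-- The collection of heads of `G`. -/
abbrev Head (G : ADMG V) : Type _ := {H : Finset V // G.IsHead H}

/-- The tail of a set `H` (used for heads). -/
noncomputable def tail (G : ADMG V) (H : Finset V) : Finset V :=
  (G.dis (G.an H) H \ H) ∪ G.pa (G.dis (G.an H) H)

/-- The strict partial order on heads. -/
def Prec (G : ADMG V) (H₁ H₂ : G.Head) : Prop := H₁ ≠ H₂ ∧ H₁.1 ⊆ G.an H₂.1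

open Classical in
/-- The maximal heads among those contained in `W`. -/
noncomputable def Phi (G : ADMG V) (W : Finset V) : Finset G.Head :=
  Finset.univ.filter fun H => H.1 ⊆ W ∧ ∀ H' : G.Head, H'.1 ⊆ W → ¬ G.Prec H H'

/-- The vertices of `W` not covered by the maximal heads contained in `W`. -/
noncomputable def psi (G : ADMG V) (W : Finset V) : Finset V :=
  W \ (G.Phi W).biUnion fun H => H.1

theorem mem_an {G : ADMG V} {W : Finset V} {w : V} :
    w ∈ G.an W ↔ ∃ v ∈ W, G.IsAncestor w v := by
  simp [an]

theorem subset_an (G : ADMG V) (W : Finset V) : W ⊆ G.an W :=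
  fun w hw => mem_an.2 ⟨w, hw, Relation.ReflTransGen.refl⟩

theorem an_subset_an {G : ADMG V} {W U : Finset V} (h : W ⊆ G.an U) : G.an W ⊆ G.an U := by
  intro w hw
  obtain ⟨v, hv, hwv⟩ := mem_an.1 hw
  obtain ⟨u, hu, hvu⟩ := mem_an.1 (h hv)
  exact mem_an.2 ⟨u, hu, Relation.ReflTransGen.trans hwv hvu⟩

theorem isHead_singleton (G : ADMG V) (v : V) : G.IsHead {v} := by
  have hv : v ∈ G.an {v} := G.subset_an {v} (Finset.mem_singleton_self v)
  refine ⟨Finset.singleton_nonempty v, ?_, v, hv, ?_⟩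
  · intro w hw
    rw [Finset.mem_singleton] at hw
    subst hw
    ext u
    simp only [Finset.mem_inter, Finset.mem_singleton, de, Finset.mem_filter, Finset.mem_univ,
      true_and, and_iff_right_iff_imp]
    rintro rfl
    exact Relation.ReflTransGen.refl
  · intro w hw
    rw [Finset.mem_singleton] at hw
    subst hw
    simp only [dis, Finset.mem_filter]
    exact ⟨hv, w, Finset.mem_singleton_self w, Relation.ReflTransGen.refl⟩

theorem subset_of_isBarren {G : ADMG V} {H H' : Finset V} (hH : G.IsBarren H)
    (h : H ⊆ G.an H') (h' : H' ⊆ G.an H) : H ⊆ H' := by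
  intro v hv
  obtain ⟨w, hw, hvw⟩ := mem_an.1 (h hv)
  obtain ⟨u, hu, hwu⟩ := mem_an.1 (h' hw)
  have hu' : u ∈ G.de v ∩ H := by
    simp only [Finset.mem_inter, de, Finset.mem_filter, Finset.mem_univ, true_and]
    exact ⟨Relation.ReflTransGen.trans hvw hwu, hu⟩
  rw [hH v hv, Finset.mem_singleton] at hu'
  subst hu'
  rw [IsAncestor.antisymm hvw hwu]
  exact hw

theorem Phi_nonempty (G : ADMG V) {W : Finset V} (hW : W.Nonempty) : (G.Phi W).Nonempty := by
  classical
  obtain ⟨v, hv⟩ := hW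
  let S : Finset G.Head := Finset.univ.filter fun H => H.1 ⊆ W
  have hS : S.Nonempty := ⟨⟨{v}, G.isHead_singleton v⟩, by simpa [S] using hv⟩
  obtain ⟨H, hHS, hmax⟩ := S.exists_max_image (fun H => (G.an H.1).card) hS
  have hHW : H.1 ⊆ W := by simpa [S] using hHS
  refine ⟨H, ?_⟩
  simp only [Phi, Finset.mem_filter, Finset.mem_univ, true_and]
  refine ⟨hHW, fun H' hH' hprec => hprec.1 ?_⟩
  have hsub : G.an H.1 ⊆ G.an H'.1 := an_subset_an hprec.2
  have heq : G.an H.1 = G.an H'.1 :=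
    Finset.eq_of_subset_of_card_le hsub (hmax H' (by simpa [S] using hH'))
  have hback : H'.1 ⊆ G.an H.1 := heq ▸ G.subset_an H'.1
  exact Subtype.ext (Finset.Subset.antisymm
    (subset_of_isBarren H.2.2.1 hprec.2 hback) (subset_of_isBarren H'.2.2.1 hback hprec.2))

theorem psi_card_lt (G : ADMG V) {W : Finset V} (hW : W.Nonempty) :
    (G.psi W).card < W.card := by
  obtain ⟨H, hH⟩ := G.Phi_nonempty hW
  obtain ⟨v, hv⟩ := H.2.1
  have hHW : H.1 ⊆ W := by
    simp only [Phi, Finset.mem_filter] at hH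
    exact hH.2.1
  refine Finset.card_lt_card (Finset.ssubset_iff_subset_ne.2 ⟨Finset.sdiff_subset, fun h => ?_⟩)
  have hvW : v ∈ G.psi W := by rw [h]; exact hHW hv
  simp only [psi, Finset.mem_sdiff, Finset.mem_biUnion, not_exists, not_and] at hvW
  exact hvW.2 H hH hv

/-- The partition `[W]` of a set `W` of vertices into heads:
`[∅] = ∅` and `[W] = Φ(W) ∪ [ψ(W)]`. -/
noncomputable def partition (G : ADMG V) (W : Finset V) : Finset G.Head :=
  if h : W.Nonempty then G.Phi W ∪ G.partition (G.psi W) else ∅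
termination_by W.card
decreasing_by exact G.psi_card_lt h

end Heads

section Model

variable {V : Type*} [Fintype V] [DecidableEq V]

open Classical in
/-- The probability of the event `E` when `p` is the probability mass function of the binary
random vector `X = (X_v)`. -/
noncomputable def prob (p : (V → Fin 2) → ℝ) (E : Set (V → Fin 2)) : ℝ :=
  ∑ y ∈ Finset.univ.filter (fun y => y ∈ E), p y

/-- The conditional probability of `E` given `F`. -/
noncomputable def condProb (p : (V → Fin 2) → ℝ) (E F : Set (V → Fin 2)) : ℝ :=
  prob p (E ∩ F) / prob p F

/-- The event `X_A = x_A`. -/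
def agree (A : Finset V) (x : V → Fin 2) : Set (V → Fin 2) := {y | ∀ v ∈ A, y v = x v}

/-- `X_A` is independent of `X_B` given `X_C`:
`P(x_A, x_B, x_C) P(x_C) = P(x_A, x_C) P(x_B, x_C)` for all values. -/
def CondIndep (p : (V → Fin 2) → ℝ) (A B C : Finset V) : Prop :=
  ∀ x : V → Fin 2,
    prob p (agree (A ∪ B ∪ C) x) * prob p (agree C x) =
      prob p (agree (A ∪ C) x) * prob p (agree (B ∪ C) x)

/-- The global Markov property. -/
def GlobalMarkov (G : ADMG V) (p : (V → Fin 2) → ℝ) : Prop :=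
  ∀ A B C : Finset V, A.Nonempty → B.Nonempty → Disjoint A B → Disjoint A C → Disjoint B C →
    G.MSeparated A B C → CondIndep p A B C

/-- The model: strictly positive probability distributions on `{0,1}^V` that obey the global
Markov property for `G`. -/
def model (G : ADMG V) : Set ((V → Fin 2) → ℝ) :=
  {p | (∀ x, 0 < p x) ∧ ∑ x, p x = 1 ∧ G.GlobalMarkov p}

/-- The index set of the parameters: a head `H` with a value `x_T` for its tail `T`. -/
abbrev ParamIndex (G : ADMG V) : Type _ := Σ H : G.Head, (G.tail H.1 → Fin 2)

/-- The parameters of a distribution: `q_H(x_T) = P(X_H = 0 | X_T = x_T)`. -/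
noncomputable def paramOf (G : ADMG V) (p : (V → Fin 2) → ℝ) : G.ParamIndex → ℝ :=
  fun i => condProb p {y | ∀ v ∈ i.1.1, y v = 0} {y | ∀ v : G.tail i.1.1, y v = i.2 v}

/-- The valid parameter vectors: the image of the model. -/
noncomputable def validParams (G : ADMG V) : Set (G.ParamIndex → ℝ) := G.paramOf '' G.model

/-- The set `x⁻¹(0)` of vertices at which `x` is zero. -/
def zeros (x : V → Fin 2) : Finset V := Finset.univ.filter fun v => x v = 0

/-- The polynomial `p_x(q)`: the sum over `C` with `x⁻¹(0) ⊆ C ⊆ V` of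
`(-1)^|C \ x⁻¹(0)|` times the product of `q_H(x_T)` over `H ∈ [C]`. -/
noncomputable def probPoly (G : ADMG V) (x : V → Fin 2) (q : G.ParamIndex → ℝ) : ℝ :=
  ∑ C ∈ Finset.univ.filter (fun C : Finset V => zeros x ⊆ C),
    (-1) ^ (C \ zeros x).card * ∏ H ∈ G.partition C, q ⟨H, fun t => x t⟩

end Model

end ADMG

/-! For a set A of vertices write m_A(x) for `marginalPoly q A x`, the alternating sum of the
theorem restricted to subsets C of A. Three identities, valid for every real vector q, carry the
proof. (1) For ancestral A, summing m_A over the two values of a vertex v without children in A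
gives m of A \ {v} (`marginalPoly_update_add`). Hence the p_x(q) sum to 1 and their margin on A is
m_A (`prob_probPoly_agree`). (2) If D is a union of districts of an ancestral A, no head contained
in A straddles D, and m_A = m_D m_{A \ D} (`marginalPoly_union_of_closed`). (3) If x_H = 0, then
m_{an(H)} = q_H(x_T) m_{an(H) \ H} (`marginalPoly_an_head`).

Suppose all p_x(q) are positive. By (1) they form a distribution, and by (3) its parameters are q.
For the Markov property let A and B be m-separated given C and let W = an(A ∪ B ∪ C). Unblocked
walks to B single out a union D of districts of W such that m_D does not involve the coordinates in
A and m_{W \ D} does not involve those in B, while they share only coordinates in C. With (2) this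
yields the independence.

Conversely, a distribution in the model has margin m_A on each ancestral A, with q its own
parameters, by induction on |A| (`prob_agree_eq_marginalPoly`). If the barren vertices of A form a
head, its law given its tail and (3) settle x_H = 0, and (1) settles the other values. Otherwise the
Markov property expresses the margin by margins on three smaller ancestral sets, and (2) gives the
same relation for the polynomials. Taking A = V gives p_x(q) = P(x) > 0. -/

namespace ADMG

/-! ### Unblocked walks and their reduction to unblocked paths -/

section Graph

variable {V : Type*} {G : ADMG V} {C : Finset V}

/-- A passage through `u` between two edges, where `h` and `h'` say whether these have an arrowhead
at `u`, is unblocked by `C`. -/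
def Passes (G : ADMG V) (C : Finset V) (h h' : Prop) (u : V) : Prop :=
  (h ∧ h' → ∃ d ∈ C, G.IsAncestor u d) ∧ (¬ (h ∧ h') → u ∉ C)

/-- The walk is unblocked by `C` if it is entered along an edge which has an arrowhead at
its first vertex if and only if `h` holds. -/
def Walk.OpenFrom (C : Finset V) : {u w : V} → Prop → G.Walk u w → Prop
  | _, _, _, .nil _ => True
  | u, _, h, .cons k _ p => G.Passes C h k.headAtSource u ∧ p.OpenFrom C k.headAtTarget

/-- Blocking concerns non-endpoints only, so it can be tested recursively, remembering just the
arrowhead mark of the edge last traversed. -/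
theorem Walk.not_blocked_cons_iff {u v w : V} (k : EdgeKind) (e : G.Edge k u v)
    (p : G.Walk v w) : ¬ (Walk.cons k e p).Blocked C ↔ p.OpenFrom C k.headAtTarget := by
  induction p generalizing u k with
  | nil v => simp [Walk.Blocked, Walk.IsNonCollider, Walk.IsCollider, Walk.OpenFrom]
  | @cons v v' w k' e' p ih =>
    rw [Walk.OpenFrom, ← ih k' e', Passes]
    simp only [Walk.Blocked, Walk.IsNonCollider, Walk.IsCollider]
    constructor
    · intro h
      push Not at h
      obtain ⟨h1, h2⟩ := h
      refine ⟨⟨fun hc => h2 v (.inl ⟨rfl, hc⟩), fun hc => h1 v (.inl ⟨rfl, fun a b => hc ⟨a, b⟩⟩)⟩, ?_⟩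
      push Not
      exact ⟨fun c hc => h1 c (.inr hc), fun c hc => h2 c (.inr hc)⟩
    · rintro ⟨⟨h1, h2⟩, h3⟩
      push Not at h3
      rintro (⟨c, ⟨rfl, hc⟩ | hc, hcC⟩ | ⟨c, ⟨rfl, hc⟩ | hc, hcC⟩)
      · exact h2 hc hcC
      · exact h3.1 c hc hcC
      · exact hcC (h1 hc)
      · obtain ⟨d, hd⟩ := h3.2 c hc
        exact hcC ⟨d, hd⟩

theorem Walk.OpenFrom.not_blocked {u w : V} {h : Prop} {p : G.Walk u w} (hp : p.OpenFrom C h) :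
    ¬ p.Blocked C := by
  cases p with
  | nil => simp [Walk.Blocked, Walk.IsNonCollider, Walk.IsCollider]
  | cons k e p => exact (Walk.not_blocked_cons_iff k e p).2 hp.2

/-- Entered along an arrowhead, the walk follows directed edges until it meets `u` or turns at a
collider, which is an ancestor of `C`. -/
theorem Walk.OpenFrom.ancestor_of_mem_support {v w u : V} {h : Prop} {p : G.Walk v w}
    (hp : p.OpenFrom C h) (hh : h) (hu : u ∈ p.support) :
    (∃ d ∈ C, G.IsAncestor v d) ∨ G.IsAncestor v u := by
  induction p generalizing h with
  | nil v =>
    simp only [Walk.support, List.mem_singleton] at hu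
    exact .inr (hu ▸ Relation.ReflTransGen.refl)
  | @cons v v' w k e p ih =>
    simp only [Walk.support, List.mem_cons] at hu
    rcases hu with rfl | hu
    · exact .inr Relation.ReflTransGen.refl
    cases k with
    | fwd =>
      rcases ih hp.2 trivial hu with ⟨d, hd, hvd⟩ | h1
      · exact .inl ⟨d, hd, Relation.ReflTransGen.head e hvd⟩
      · exact .inr (Relation.ReflTransGen.head e h1)
    | bwd => exact .inl (hp.1.1 ⟨hh, trivial⟩)
    | bidir => exact .inl (hp.1.1 ⟨hh, trivial⟩)

theorem Walk.OpenFrom.exists_suffix {v w u : V} {h : Prop} {p : G.Walk v w}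
    (hp : p.OpenFrom C h) (hpath : p.IsPath) (hu : u ∈ p.support) :
    ∃ (h' : Prop) (p' : G.Walk u w), p'.OpenFrom C h' ∧ p'.IsPath := by
  induction p generalizing h with
  | nil v =>
    simp only [Walk.support, List.mem_singleton] at hu
    subst hu
    exact ⟨h, _, hp, hpath⟩
  | @cons v v' w k e p ih =>
    by_cases huv : u = v
    · subst huv
      exact ⟨h, _, hp, hpath⟩
    · simp only [Walk.support, List.mem_cons, huv, false_or] at hu
      exact ih hp.2 (List.nodup_cons.1 hpath).2 hu

/-- Removing loops from an unblocked walk leaves an unblocked path. -/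
theorem Walk.OpenFrom.exists_path {u w : V} {h : Prop} {p : G.Walk u w} (hp : p.OpenFrom C h) :
    ∃ p' : G.Walk u w, p'.OpenFrom C h ∧ p'.IsPath := by
  induction p generalizing h with
  | nil u => exact ⟨.nil u, trivial, by simp [Walk.IsPath, Walk.support]⟩
  | @cons u v w k e p ih =>
    obtain ⟨p₁, hp₁, hpath⟩ := ih hp.2
    by_cases hu : u ∈ p₁.support
    · obtain ⟨h', p₂, hp₂, hpath₂⟩ := hp₁.exists_suffix hpath hu
      refine ⟨p₂, ?_, hpath₂⟩
      cases p₂ with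
      | nil => trivial
      | cons k₂ e₂ p₃ =>
        -- Cutting out the loop pairs the mark entering the first visit of `u` with the mark leaving
        -- a later one. A collider created at `u` is an ancestor of `C`: otherwise the loop would be
        -- a directed cycle. A non-collider at `u` was already one at one of the two visits.
        refine ⟨⟨fun hc => ?_, fun hc => ?_⟩, hp₂.2⟩
        · cases k with
          | fwd =>
            rcases hp₁.ancestor_of_mem_support trivial hu with ⟨d, hd, hvd⟩ | hvu
            · exact ⟨d, hd, Relation.ReflTransGen.head e hvd⟩
            · exact absurd (Relation.TransGen.head' e hvu) (G.acyclic u)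
          | bwd => exact hp.1.1 ⟨hc.1, trivial⟩
          | bidir => exact hp.1.1 ⟨hc.1, trivial⟩
        · by_cases hh : h
          · exact hp₂.1.2 fun h2 => hc ⟨hh, h2.2⟩
          · exact hp.1.2 fun h2 => hh h2.1
    · exact ⟨.cons k e p₁, ⟨hp.1, hp₁⟩, List.nodup_cons.2 ⟨hu, hpath⟩⟩

/-! ### Vertices joined to `B` by unblocked walks -/

/-- `G.Conn B C v h`: there is a walk from `v` to a member of `B` which is unblocked by `C`;
`h` says whether its first edge has an arrowhead at `v`. -/
inductive Conn (G : ADMG V) (B C : Finset V) : V → Prop → Prop where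
  | base {b : V} (hb : b ∈ B) : Conn G B C b False
  | step {v w : V} {h : Prop} (k : EdgeKind) (e : G.Edge k w v)
      (hv : G.Passes C k.headAtTarget h v) (hc : Conn G B C v h) : Conn G B C w k.headAtSource

theorem Conn.exists_walk {B : Finset V} {v : V} {h : Prop} (hc : G.Conn B C v h) :
    ∃ b ∈ B, ∃ p : G.Walk v b, ∀ s, G.Passes C s h v → p.OpenFrom C s := by
  induction hc with
  | @base b hb => exact ⟨b, hb, .nil b, fun _ _ => trivial⟩
  | @step v w h k e hv _ ih =>
    obtain ⟨b, hb, p, hp⟩ := ih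
    exact ⟨b, hb, .cons k e p, fun s hs => ⟨hs, hp _ hv⟩⟩

theorem MSeparated.not_conn {A B : Finset V} (hsep : G.MSeparated A B C) (hAC : Disjoint A C)
    {a : V} (ha : a ∈ A) (h : Prop) : ¬ G.Conn B C a h := by
  intro hc
  obtain ⟨b, hb, p, hp⟩ := hc.exists_walk
  have haC : a ∉ C := Finset.disjoint_left.1 hAC ha
  obtain ⟨p', hp', hpath⟩ := (hp False ⟨fun h => h.1.elim, fun _ => haC⟩).exists_path
  exact hp'.not_blocked (hsep a ha b hb p' hpath)

variable {A B : Finset V}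

theorem Conn.child {v w : V} {h : Prop} (hc : G.Conn B C v h) (hv : v ∉ C) (e : G.dir v w) :
    G.Conn B C w True :=
  .step (k := .bwd) (h := h) (v := v) e ⟨fun h => h.1.elim, fun _ => hv⟩ hc

theorem Conn.of_ancestor {v : V} (hv : ∃ b ∈ B, G.IsAncestor v b)
    (hvC : ¬ ∃ d ∈ C, G.IsAncestor v d) : G.Conn B C v False := by
  obtain ⟨b, hb, hvb⟩ := hv
  induction hvb using Relation.ReflTransGen.head_induction_on with
  | refl => exact .base hb
  | @head v w e hwb ih =>
    have hw : ¬ ∃ d ∈ C, G.IsAncestor w d := fun ⟨d, hd, hwd⟩ => hvC ⟨d, hd, .head e hwd⟩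
    exact .step (k := .fwd) (v := w) e
      ⟨fun h => h.2.elim, fun _ hwC => hw ⟨w, hwC, .refl⟩⟩ (ih hw)

theorem Conn.of_isAncestor {v a : V} (hc : G.Conn B C v True) (hva : G.IsAncestor v a)
    (hvC : ¬ ∃ d ∈ C, G.IsAncestor v d) : G.Conn B C a True := by
  induction hva using Relation.ReflTransGen.head_induction_on with
  | refl => exact hc
  | @head v w e hwb ih =>
    exact ih (hc.child (fun hv => hvC ⟨v, hv, .refl⟩) e)
      fun ⟨d, hd, hwd⟩ => hvC ⟨d, hd, .head e hwd⟩

/-- In the set of ancestors of `A ∪ B ∪ C`, every edge with an arrowhead at a vertex that is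
reached extends the connection. -/
theorem MSeparated.conn_of_edge (hsep : G.MSeparated A B C) (hAC : Disjoint A C) {v w : V}
    (hv : (∃ a ∈ A, G.IsAncestor v a) ∨ (∃ b ∈ B, G.IsAncestor v b) ∨ ∃ d ∈ C, G.IsAncestor v d)
    (hc : G.Conn B C v True ∨ (∃ h, G.Conn B C v h) ∧ v ∉ C) (k : EdgeKind)
    (hk : k.headAtTarget) (e : G.Edge k w v) : G.Conn B C w k.headAtSource := by
  -- The new edge makes `v` a collider if the old walk has an arrowhead at `v`, which is harmless
  -- when `v` is an ancestor of `C`. Otherwise a walk without arrowhead at `v` is needed. If there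
  -- is none, an ancestor `v` of `B` is excluded by its directed path to `B`, and an ancestor of `A`
  -- by prolonging the walk down to `A`.
  by_cases hvC : ∃ d ∈ C, G.IsAncestor v d
  · rcases hc with hc | ⟨⟨h, hc⟩, hv'⟩
    · exact .step k e ⟨fun _ => hvC, fun h => absurd ⟨hk, trivial⟩ h⟩ hc
    · exact .step k e ⟨fun _ => hvC, fun _ => hv'⟩ hc
  have hv' : v ∉ C := fun h => hvC ⟨v, h, .refl⟩
  by_cases hcf : G.Conn B C v False
  · exact .step k e ⟨fun h => h.2.elim, fun _ => hv'⟩ hcf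
  have hct : G.Conn B C v True := by
    rcases hc with hc | ⟨⟨h, hc⟩, -⟩
    · exact hc
    · by_cases hh : h
      · simpa [hh] using hc
      · simp [hh, hcf] at hc
  rcases hv with ⟨a, ha, hva⟩ | hvB | hv
  · exact absurd (hct.of_isAncestor hva hvC) (hsep.not_conn hAC ha _)
  · exact absurd (Conn.of_ancestor hvB hvC) hcf
  · exact absurd hv hvC

/-- A walk into the complement of an ancestral set `A` does not come back to it without being
blocked by a subset of `A`. -/
theorem Walk.OpenFrom.not_mem_of_not_mem {S : Set V} (hS : ∀ v w, G.dir v w → w ∈ S → v ∈ S)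
    (hC : ∀ c ∈ C, c ∈ S) {u w : V} {h : Prop} {p : G.Walk u w} (hp : p.OpenFrom C h) (hh : h)
    (hu : u ∉ S) : w ∉ S := by
  have hanc : ∀ {u d}, G.IsAncestor u d → d ∈ S → u ∈ S := by
    intro u d hud hd
    induction hud using Relation.ReflTransGen.head_induction_on with
    | refl => exact hd
    | head e _ ih => exact hS _ _ e ih
  induction p generalizing h with
  | nil => exact hu
  | @cons u v w k e p ih =>
    have hcol : ¬ k.headAtSource := fun hk => by
      obtain ⟨d, hd, hud⟩ := hp.1.1 ⟨hh, hk⟩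
      exact hu (hanc hud (hC d hd))
    cases k with
    | fwd => exact ih hp.2 trivial fun hv => hu (hS _ _ e hv)
    | bwd => exact (hcol trivial).elim
    | bidir => exact (hcol trivial).elim

end Graph

end ADMG

namespace ADMG

/-! ### A district-based criterion for m-separation -/

section Graph

variable {V : Type*} {G : ADMG V}

/-- Let `B` be a set of vertices without children in an ancestral set `A` which is contained in a
union `D` of districts of `A`. Then `B` is m-separated from the vertices of `A` outside `D` and the
parents of `D`, given any subset of `A` that contains the rest of `D` and the parents of `D`. -/
theorem mSeparated_of_district {A B D E T : Finset V} (hA : ∀ v w, G.dir v w → w ∈ A → v ∈ A)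
    (hD : ∀ d ∈ D, ∀ w ∈ A, G.bi d w → w ∈ D) (hBD : B ⊆ D)
    (hB : ∀ b ∈ B, ∀ w ∈ A, ¬ G.dir b w) (hDT : ∀ d ∈ D, d ∉ B → d ∈ T)
    (hpT : ∀ d ∈ D, ∀ w, G.dir w d → w ∈ T) (hTA : T ⊆ A) (hEA : E ⊆ A)
    (hED : ∀ e ∈ E, e ∉ D) (hET : ∀ e ∈ E, e ∉ T) : G.MSeparated B E T := by
  -- Invariant: the walk stands in `D`, and an outgoing edge `w → u` occurs only at `w ∈ B`. Such an
  -- edge leaves `A` for good, a step to a parent meets a non-collider in `T`, and a bidirected edge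
  -- inside `A` stays in `D`.
  have key : ∀ {w u e : V} (_ : e ∈ E) (k : EdgeKind) (_ : G.Edge k w u) (p : G.Walk u e),
      w ∈ D → (k = .fwd → w ∈ B) → ¬ p.OpenFrom T k.headAtTarget := by
    intro w u e he k e' p hw hk hp
    induction p generalizing w k with
    | nil u =>
      cases k with
      | fwd => exact hB w (hk rfl) u (hEA he) e'
      | bwd => exact hET u he (hpT w hw u e')
      | bidir => exact hED u he (hD w hw u (hEA he) e')
    | @cons u u' e k₁ e₁ p ih =>
      have hout : k.headAtTarget → u ∉ A → False := fun hkt hu =>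
        Walk.OpenFrom.not_mem_of_not_mem (S := {v | v ∈ A}) hA (fun c hc => hTA hc) hp hkt hu
          (hEA he)
      cases k with
      | fwd => exact hout trivial fun hu => hB w (hk rfl) u hu e'
      | bwd => exact hp.1.2 (fun h => h.1) (hpT w hw u e')
      | bidir =>
        by_cases hu : u ∈ A
        · have huD := hD w hw u hu e'
          refine ih he k₁ e₁ huD ?_ hp.2
          rintro rfl
          by_contra huB
          exact hp.1.2 (fun h => h.2) (hDT u huD huB)
        · exact hout trivial hu
  intro b hb e he p _
  by_contra hp
  cases p with
  | nil => exact hED b he (hBD hb)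
  | cons k e' p =>
    exact key he k e' p (hBD hb) (fun _ => hb) ((Walk.not_blocked_cons_iff k e' p).1 hp)

end Graph

/-! ### Ancestral sets, districts, and the partition into heads -/

section Heads

set_option linter.unusedSectionVars false

variable {V : Type*} [Fintype V] [DecidableEq V] {G : ADMG V}

theorem wellFounded_transGen (G : ADMG V) : WellFounded (Relation.TransGen G.dir) :=
  haveI : Std.Irrefl (Relation.TransGen G.dir) := ⟨G.acyclic⟩
  Finite.wellFounded_of_trans_of_irrefl _

theorem wellFounded_swap_transGen (G : ADMG V) :
    WellFounded (Function.swap (Relation.TransGen G.dir)) :=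
  haveI : Std.Irrefl (Function.swap (Relation.TransGen G.dir)) := ⟨G.acyclic⟩
  haveI : IsTrans V (Function.swap (Relation.TransGen G.dir)) := ⟨fun _ _ _ h h' => h'.trans h⟩
  Finite.wellFounded_of_trans_of_irrefl _

/-- `A` is an ancestral set. -/
def IsAncestral (G : ADMG V) (A : Finset V) : Prop := ∀ v w, G.dir v w → w ∈ A → v ∈ A

theorem IsAncestral.an_subset {A W : Finset V} (hA : G.IsAncestral A) (hW : W ⊆ A) :
    G.an W ⊆ A := by
  intro v hv
  obtain ⟨w, hw, hvw⟩ := mem_an.1 hv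
  induction hvw using Relation.ReflTransGen.head_induction_on with
  | refl => exact hW hw
  | @head v u e huw ih => exact hA _ _ e (ih (mem_an.2 ⟨w, hw, huw⟩))

theorem isAncestral_an (W : Finset V) : G.IsAncestral (G.an W) := by
  intro v w e hw
  obtain ⟨u, hu, hwu⟩ := mem_an.1 hw
  exact mem_an.2 ⟨u, hu, .head e hwu⟩

theorem IsAncestral.erase {A : Finset V} (hA : G.IsAncestral A) {v : V}
    (hv : ∀ w ∈ A, ¬ G.dir v w) : G.IsAncestral (A.erase v) := by
  intro u w e hw
  refine Finset.mem_erase.2 ⟨?_, hA u w e (Finset.mem_of_mem_erase hw)⟩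
  rintro rfl
  exact hv w (Finset.mem_of_mem_erase hw) e

theorem isBarren_iff {B : Finset V} :
    G.IsBarren B ↔ ∀ v ∈ B, ∀ w ∈ B, G.IsAncestor v w → w = v := by
  refine forall₂_congr fun v hv => ?_
  constructor
  · intro h w hw hvw
    have : w ∈ G.de v ∩ B := by simp [de, hvw, hw]
    rwa [h, Finset.mem_singleton] at this
  · intro h
    ext w
    simp only [de, Finset.mem_inter, Finset.mem_filter, Finset.mem_univ, true_and,
      Finset.mem_singleton]
    refine ⟨fun hw => h w hw.2 hw.1, ?_⟩
    rintro rfl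
    exact ⟨.refl, hv⟩

theorem mem_dis {A W : Finset V} {w : V} : w ∈ G.dis A W ↔ w ∈ A ∧ ∃ v ∈ W,
    Relation.ReflTransGen (fun a b => a ∈ A ∧ b ∈ A ∧ G.bi a b) v w := by
  simp [dis]

theorem reflTransGen_bi_symm {A : Finset V} {v w : V}
    (h : Relation.ReflTransGen (fun a b => a ∈ A ∧ b ∈ A ∧ G.bi a b) v w) :
    Relation.ReflTransGen (fun a b => a ∈ A ∧ b ∈ A ∧ G.bi a b) w v := by
  induction h with
  | refl => exact .refl
  | tail _ e ih => exact .head ⟨e.2.1, e.1, G.bi_symm _ _ e.2.2⟩ ih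

theorem reflTransGen_bi_mono {A A' : Finset V} (hA : A ⊆ A') {v w : V}
    (h : Relation.ReflTransGen (fun a b => a ∈ A ∧ b ∈ A ∧ G.bi a b) v w) :
    Relation.ReflTransGen (fun a b => a ∈ A' ∧ b ∈ A' ∧ G.bi a b) v w := by
  induction h with
  | refl => exact .refl
  | tail _ e ih => exact ih.tail ⟨hA e.1, hA e.2.1, e.2.2⟩

theorem subset_dis {A W : Finset V} (h : W ⊆ A) : W ⊆ G.dis A W :=
  fun w hw => mem_dis.2 ⟨h hw, w, hw, .refl⟩

theorem dis_subset {A W : Finset V} : G.dis A W ⊆ A := fun _ hw => (mem_dis.1 hw).1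

theorem mem_dis_of_bi {A W : Finset V} {d w : V} (hd : d ∈ G.dis A W) (hw : w ∈ A)
    (e : G.bi d w) : w ∈ G.dis A W := by
  obtain ⟨hdA, v, hv, h⟩ := mem_dis.1 hd
  exact mem_dis.2 ⟨hw, v, hv, h.tail ⟨hdA, hw, e⟩⟩

theorem mem_pa {W : Finset V} {w : V} : w ∈ G.pa W ↔ ∃ v ∈ W, G.dir w v := by
  simp [pa]

/-- A set of vertices of `A` that is closed under the bidirected edges of `A` contains every
vertex that is joined to it within a subset of `A`. -/
theorem mem_of_reflTransGen_bi {A A' D : Finset V} (hA : A ⊆ A')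
    (hD : ∀ d ∈ D, ∀ w ∈ A', G.bi d w → w ∈ D) {v w : V} (hv : v ∈ D)
    (h : Relation.ReflTransGen (fun a b => a ∈ A ∧ b ∈ A ∧ G.bi a b) v w) : w ∈ D := by
  induction h with
  | refl => exact hv
  | tail _ e ih => exact hD _ ih _ (hA e.2.1) e.2.2

theorem isHead_iff {H : Finset V} : G.IsHead H ↔ H.Nonempty ∧ G.IsBarren H ∧ ∀ v ∈ H, ∀ w ∈ H,
    Relation.ReflTransGen (fun a b => a ∈ G.an H ∧ b ∈ G.an H ∧ G.bi a b) v w := by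
  constructor
  · rintro ⟨hne, hb, v, -, h⟩
    refine ⟨hne, hb, fun u hu w hw => ?_⟩
    obtain ⟨-, _, h1, hu'⟩ := mem_dis.1 (h hu)
    obtain ⟨-, _, h2, hw'⟩ := mem_dis.1 (h hw)
    rw [Finset.mem_singleton] at h1 h2
    subst h1 h2
    exact (reflTransGen_bi_symm hu').trans hw'
  · rintro ⟨⟨v, hv⟩, hb, h⟩
    exact ⟨⟨v, hv⟩, hb, v, G.subset_an H hv, fun w hw =>
      mem_dis.2 ⟨G.subset_an H hw, v, Finset.mem_singleton_self v, h v hv w hw⟩⟩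

/-- A head is connected by bidirected edges within its ancestors, hence within `A`, so it cannot
straddle a union of districts of `A`. -/
theorem IsHead.subset_of_mem {A D H : Finset V} (hH : G.IsHead H) (hA : G.IsAncestral A)
    (hHA : H ⊆ A) (hD : ∀ d ∈ D, ∀ w ∈ A, G.bi d w → w ∈ D) {v : V} (hv : v ∈ H) (hvD : v ∈ D) :
    H ⊆ D := fun w hw =>
  mem_of_reflTransGen_bi (hA.an_subset hHA) hD hvD ((isHead_iff.1 hH).2.2 v hv w hw)

/-- This keeps a vertex without children in an ancestral set out of the tails of all heads in that
set, so that it can be summed out. -/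
theorem exists_dir_of_mem_tail {H : Finset V} {v : V} (hv : v ∈ G.tail H) :
    ∃ w ∈ G.an H, G.dir v w := by
  rcases Finset.mem_union.1 hv with hv | hv
  · obtain ⟨hvd, hvH⟩ := Finset.mem_sdiff.1 hv
    obtain ⟨h, hh, hvh⟩ := mem_an.1 (dis_subset hvd)
    rcases Relation.ReflTransGen.cases_head hvh with rfl | ⟨w, e, hwh⟩
    · exact absurd hh hvH
    · exact ⟨w, mem_an.2 ⟨h, hh, hwh⟩, e⟩
  · obtain ⟨w, hw, e⟩ := mem_pa.1 hv
    exact ⟨w, dis_subset hw, e⟩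

theorem tail_subset_an {H : Finset V} : G.tail H ⊆ G.an H := fun v hv => by
  obtain ⟨w, hw, e⟩ := exists_dir_of_mem_tail hv
  exact isAncestral_an H v w e hw

theorem not_dir_of_isBarren {H : Finset V} (hH : G.IsBarren H) {v w : V} (hv : v ∈ H)
    (hw : w ∈ G.an H) : ¬ G.dir v w := by
  intro e
  obtain ⟨u, hu, hwu⟩ := mem_an.1 hw
  have := isBarren_iff.1 hH v hv u hu (.head e hwu)
  subst this
  exact G.acyclic _ (Relation.TransGen.head' e hwu)

theorem disjoint_tail {H : Finset V} (hH : G.IsBarren H) : Disjoint H (G.tail H) := by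
  refine Finset.disjoint_left.2 fun v hv hvT => ?_
  obtain ⟨w, hw, e⟩ := exists_dir_of_mem_tail hvT
  exact not_dir_of_isBarren hH hv hw e

open Classical in
/-- The members of `W` without proper descendants in `W`. -/
noncomputable def barren (G : ADMG V) (W : Finset V) : Finset V :=
  W.filter fun v => ∀ w ∈ W, G.IsAncestor v w → w = v

theorem mem_barren {W : Finset V} {v : V} :
    v ∈ G.barren W ↔ v ∈ W ∧ ∀ w ∈ W, G.IsAncestor v w → w = v := by
  simp [barren]

theorem barren_subset {W : Finset V} : G.barren W ⊆ W := fun _ hv => (mem_barren.1 hv).1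

theorem isBarren_barren {W : Finset V} : G.IsBarren (G.barren W) :=
  isBarren_iff.2 fun _ hv w hw => (mem_barren.1 hv).2 w (barren_subset hw)

theorem subset_an_barren {W : Finset V} : W ⊆ G.an (G.barren W) := by
  intro v
  induction v using G.wellFounded_swap_transGen.induction with
  | _ v ih =>
    intro hv
    by_cases hvb : v ∈ G.barren W
    · exact G.subset_an _ hvb
    · have : ∃ w ∈ W, G.IsAncestor v w ∧ w ≠ v := by
        by_contra h
        push Not at h
        exact hvb (mem_barren.2 ⟨hv, h⟩)
      obtain ⟨w, hw, hvw, hne⟩ := this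
      have htr : Relation.TransGen G.dir v w :=
        (Relation.reflTransGen_iff_eq_or_transGen.1 hvw).resolve_left hne
      obtain ⟨u, hu, hwu⟩ := mem_an.1 (ih w htr hw)
      exact mem_an.2 ⟨u, hu, Relation.ReflTransGen.trans hvw hwu⟩

/-- Two heads with a common vertex are both contained in the ancestors of a head contained in
their union. -/
theorem IsHead.exists_union {H₁ H₂ : Finset V} (h₁ : G.IsHead H₁) (h₂ : G.IsHead H₂) {v : V}
    (hv₁ : v ∈ H₁) (hv₂ : v ∈ H₂) :
    ∃ H, G.IsHead H ∧ H ⊆ H₁ ∪ H₂ ∧ H₁ ⊆ G.an H ∧ H₂ ⊆ G.an H := by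
  have hsub : H₁ ∪ H₂ ⊆ G.an (G.barren (H₁ ∪ H₂)) := subset_an_barren
  have hs₁ := Finset.union_subset_left hsub
  have hs₂ := Finset.union_subset_right hsub
  refine ⟨G.barren (H₁ ∪ H₂), isHead_iff.2 ⟨?_, isBarren_barren, ?_⟩, barren_subset, hs₁, hs₂⟩
  · obtain ⟨u, hu, -⟩ := mem_an.1 (hs₁ hv₁)
    exact ⟨u, hu⟩
  · have key : ∀ w ∈ H₁ ∪ H₂, Relation.ReflTransGen (fun a b => a ∈ G.an (G.barren (H₁ ∪ H₂)) ∧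
        b ∈ G.an (G.barren (H₁ ∪ H₂)) ∧ G.bi a b) v w := by
      intro w hw
      rcases Finset.mem_union.1 hw with hw | hw
      · exact reflTransGen_bi_mono (an_subset_an hs₁) ((isHead_iff.1 h₁).2.2 v hv₁ w hw)
      · exact reflTransGen_bi_mono (an_subset_an hs₂) ((isHead_iff.1 h₂).2.2 v hv₂ w hw)
    intro u hu w hw
    exact (reflTransGen_bi_symm (key u (barren_subset hu))).trans (key w (barren_subset hw))

theorem mem_Phi {W : Finset V} {H : G.Head} :
    H ∈ G.Phi W ↔ H.1 ⊆ W ∧ ∀ H' : G.Head, H'.1 ⊆ W → ¬ G.Prec H H' := by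
  simp [Phi]

/-- Two intersecting heads lie below a head contained in their union; by maximality both equal it.
-/
theorem disjoint_of_mem_Phi {W : Finset V} {H₁ H₂ : G.Head} (h₁ : H₁ ∈ G.Phi W)
    (h₂ : H₂ ∈ G.Phi W) (hne : H₁ ≠ H₂) : Disjoint H₁.1 H₂.1 := by
  by_contra h
  obtain ⟨v, hv₁, hv₂⟩ := Finset.not_disjoint_iff.1 h
  obtain ⟨H, hH, hsub, hs₁, hs₂⟩ := H₁.2.exists_union H₂.2 hv₁ hv₂
  rw [mem_Phi] at h₁ h₂
  have hHW : H ⊆ W := hsub.trans (Finset.union_subset h₁.1 h₂.1)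
  have e₁ : H₁ = ⟨H, hH⟩ := by
    by_contra hn
    exact h₁.2 ⟨H, hH⟩ hHW ⟨hn, hs₁⟩
  have e₂ : H₂ = ⟨H, hH⟩ := by
    by_contra hn
    exact h₂.2 ⟨H, hH⟩ hHW ⟨hn, hs₂⟩
  exact hne (e₁.trans e₂.symm)

theorem mem_Phi_sdiff {W : Finset V} {H₁ H₂ : G.Head} (h₁ : H₁ ∈ G.Phi W)
    (h₂ : H₂ ∈ G.Phi W) (hne : H₁ ≠ H₂) : H₁ ∈ G.Phi (W \ H₂.1) := by
  have hd := disjoint_of_mem_Phi h₁ h₂ hne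
  rw [mem_Phi] at h₁ ⊢
  exact ⟨Finset.subset_sdiff.2 ⟨h₁.1, hd⟩, fun H' hH' => h₁.2 H' (hH'.trans Finset.sdiff_subset)⟩

theorem partition_empty : G.partition ∅ = ∅ := by
  rw [partition]; simp

theorem partition_of_nonempty {W : Finset V} (hW : W.Nonempty) :
    G.partition W = G.Phi W ∪ G.partition (G.psi W) := by
  rw [partition]; simp [hW]

theorem subset_of_mem_partition {W : Finset V} {H : G.Head} (h : H ∈ G.partition W) :
    H.1 ⊆ W := by
  induction hn : W.card using Nat.strong_induction_on generalizing W with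
  | _ n ih =>
    subst hn
    rcases W.eq_empty_or_nonempty with rfl | hW
    · simp [partition_empty] at h
    · rw [partition_of_nonempty hW, Finset.mem_union] at h
      rcases h with h | h
      · exact (mem_Phi.1 h).1
      · exact (ih _ (G.psi_card_lt hW) h rfl).trans Finset.sdiff_subset

/-- The partition of `W` is obtained by removing the maximal heads one at a time. -/
theorem partition_eq_insert {W : Finset V} {H : G.Head} (hH : H ∈ G.Phi W) :
    G.partition W = insert H (G.partition (W \ H.1)) := by
  induction hn : W.card using Nat.strong_induction_on generalizing W H with
  | _ n ih =>
    subst hn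
    have hcard : (W \ H.1).card < W.card := by
      have := Finset.card_lt_card (Finset.sdiff_ssubset (mem_Phi.1 hH).1 H.2.1)
      exact this
    -- By the induction hypothesis, any family of maximal heads of a smaller set can be removed. The
    -- other maximal heads of `W` remain maximal in `W \ H.1`, and removing them all leaves `psi W`.
    have key : ∀ (S : Finset G.Head) (U : Finset V), U.card < W.card → S ⊆ G.Phi U →
        G.partition U = S ∪ G.partition (U \ S.biUnion fun H => H.1) := by
      intro S
      induction S using Finset.induction_on with
      | empty => intro U _ _; simp
      | insert K S hK ihS =>
        intro U hU hS
        have hKU : K ∈ G.Phi U := hS (Finset.mem_insert_self K S)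
        have h1 := ih U.card hU hKU rfl
        have h2 := ihS (U \ K.1) ((Finset.card_le_card Finset.sdiff_subset).trans_lt hU)
          fun L hL => mem_Phi_sdiff (hS (Finset.mem_insert_of_mem hL)) hKU
            (by rintro rfl; exact hK hL)
        rw [h1, h2, Finset.biUnion_insert, Finset.insert_union, sdiff_sdiff_left]
        rfl
    have hne : W.Nonempty := H.2.1.mono (mem_Phi.1 hH).1
    rw [partition_of_nonempty hne, key ((G.Phi W).erase H) _ hcard, ← Finset.insert_union,
      Finset.insert_erase hH, psi]
    · congr 2
      conv_lhs => rw [← Finset.insert_erase hH, Finset.biUnion_insert]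
      exact sdiff_sdiff_left.symm
    · intro K hK
      rw [Finset.mem_erase] at hK
      exact mem_Phi_sdiff hK.2 hH hK.1

/-- If every head contained in `W₁ ∪ W₂` is contained in `W₁` or in `W₂`, then the partition
splits. -/
theorem partition_union {W₁ W₂ : Finset V} (hd : Disjoint W₁ W₂)
    (hs : ∀ H, G.IsHead H → H ⊆ W₁ ∪ W₂ → H ⊆ W₁ ∨ H ⊆ W₂) :
    G.partition (W₁ ∪ W₂) = G.partition W₁ ∪ G.partition W₂ := by
  induction hn : (W₁ ∪ W₂).card using Nat.strong_induction_on generalizing W₁ W₂ with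
  | _ n ih =>
    subst hn
    rcases (W₁ ∪ W₂).eq_empty_or_nonempty with h0 | hne
    · obtain ⟨rfl, rfl⟩ := Finset.union_eq_empty.1 h0
      simp [partition_empty]
    obtain ⟨H, hH⟩ := G.Phi_nonempty hne
    obtain ⟨hHW, hmax⟩ := mem_Phi.1 hH
    have hcard := Finset.card_lt_card (Finset.sdiff_ssubset hHW H.2.1)
    -- A maximal head of the union lies in one of the two sets and is maximal there, so it can be
    -- removed on both sides. Stating this for `U₁`, `U₂` covers both cases by symmetry.
    have step : ∀ {U₁ U₂ : Finset V}, W₁ ∪ W₂ = U₁ ∪ U₂ → Disjoint U₁ U₂ →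
        (∀ H, G.IsHead H → H ⊆ U₁ ∪ U₂ → H ⊆ U₁ ∨ H ⊆ U₂) → H.1 ⊆ U₁ →
        G.partition (U₁ ∪ U₂) = G.partition U₁ ∪ G.partition U₂ := by
      intro U₁ U₂ hU hdU hsU hHU
      have hHU₂ : U₂ \ H.1 = U₂ :=
        Finset.sdiff_eq_self_of_disjoint (Finset.disjoint_of_subset_left hHU hdU).symm
      have h1 : (U₁ ∪ U₂) \ H.1 = (U₁ \ H.1) ∪ U₂ := by
        rw [Finset.union_sdiff_distrib, hHU₂]
      have hPhi : H ∈ G.Phi U₁ := mem_Phi.2 ⟨hHU, fun H' hH' => hmax H' (by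
        rw [hU]; exact hH'.trans Finset.subset_union_left)⟩
      rw [hU] at hcard hH
      rw [h1] at hcard
      rw [partition_eq_insert hH, h1, partition_eq_insert hPhi, Finset.insert_union]
      congr 1
      refine ih _ (by rwa [hU]) (Finset.disjoint_of_subset_left Finset.sdiff_subset hdU)
        (fun K hK hKs => ?_) rfl
      rw [← h1] at hKs
      rcases hsU K hK (hKs.trans Finset.sdiff_subset) with h | h
      · exact .inl (Finset.subset_sdiff.2 ⟨h, (Finset.subset_sdiff.1 hKs).2⟩)
      · exact .inr h
    rcases hs H.1 H.2 hHW with h | h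
    · exact step rfl hd hs h
    · rw [Finset.union_comm, Finset.union_comm (G.partition W₁)]
      refine step (Finset.union_comm ..) hd.symm (fun K hK hKs => ?_) h
      rw [Finset.union_comm] at hKs
      exact (hs K hK hKs).symm

theorem disjoint_partition {W₁ W₂ : Finset V} (hd : Disjoint W₁ W₂) :
    Disjoint (G.partition W₁) (G.partition W₂) := by
  refine Finset.disjoint_left.2 fun H h₁ h₂ => ?_
  obtain ⟨v, hv⟩ := H.2.1
  exact Finset.disjoint_left.1 hd (subset_of_mem_partition h₁ hv) (subset_of_mem_partition h₂ hv)

end Heads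

end ADMG

namespace ADMG

/-! ### Identities for the polynomials -/

section Polynomial

set_option linter.unusedSectionVars false

variable {V : Type*} [Fintype V] [DecidableEq V] {G : ADMG V}

/-- The product of the parameters that belong to the heads of the partition of `C`. -/
noncomputable def headProd (G : ADMG V) (q : G.ParamIndex → ℝ) (x : V → Fin 2) (C : Finset V) : ℝ :=
  ∏ H ∈ G.partition C, q ⟨H, fun t => x t⟩

/-- The analogue of `probPoly` for a subset `A` of the vertices. -/
noncomputable def marginalPoly (G : ADMG V) (q : G.ParamIndex → ℝ) (A : Finset V)
    (x : V → Fin 2) : ℝ :=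
  ∑ C ∈ A.powerset.filter (fun C => zeros x ∩ A ⊆ C),
    (-1) ^ (C \ zeros x).card * G.headProd q x C

theorem mem_zeros {x : V → Fin 2} {v : V} : v ∈ zeros x ↔ x v = 0 := by simp [zeros]

theorem marginalPoly_univ (q : G.ParamIndex → ℝ) (x : V → Fin 2) :
    G.marginalPoly q Finset.univ x = G.probPoly x q := by
  simp [marginalPoly, probPoly, headProd]

theorem marginalPoly_empty (q : G.ParamIndex → ℝ) (x : V → Fin 2) :
    G.marginalPoly q ∅ x = 1 := by
  simp [marginalPoly, headProd, partition_empty]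

theorem headProd_congr (q : G.ParamIndex → ℝ) {C : Finset V} {x x' : V → Fin 2}
    (h : ∀ H, G.IsHead H → H ⊆ C → ∀ v ∈ G.tail H, x v = x' v) :
    G.headProd q x C = G.headProd q x' C := by
  refine Finset.prod_congr rfl fun H hH => ?_
  congr 2
  funext t
  exact h H.1 H.2 (subset_of_mem_partition hH) t t.2

theorem marginalPoly_congr (q : G.ParamIndex → ℝ) {W S : Finset V} (hWS : W ⊆ S)
    (hS : ∀ H, G.IsHead H → H ⊆ W → G.tail H ⊆ S) {x x' : V → Fin 2}
    (hx : ∀ v ∈ S, x v = x' v) : G.marginalPoly q W x = G.marginalPoly q W x' := by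
  have hz : ∀ v ∈ W, (v ∈ zeros x ↔ v ∈ zeros x') := fun v hv => by
    rw [mem_zeros, mem_zeros, hx v (hWS hv)]
  have hz' : zeros x ∩ W = zeros x' ∩ W := by
    ext v
    simp only [Finset.mem_inter]
    exact ⟨fun h => ⟨(hz v h.2).1 h.1, h.2⟩, fun h => ⟨(hz v h.2).2 h.1, h.2⟩⟩
  unfold marginalPoly
  rw [hz']
  refine Finset.sum_congr rfl fun C hC => ?_
  have hCW : C ⊆ W := Finset.mem_powerset.1 (Finset.mem_filter.1 hC).1
  rw [headProd_congr q fun H hH hHC v hv => hx v (hS H hH (hHC.trans hCW) hv)]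
  congr 3
  ext v
  simp only [Finset.mem_sdiff]
  exact ⟨fun h => ⟨h.1, fun h' => h.2 ((hz v (hCW h.1)).2 h')⟩,
    fun h => ⟨h.1, fun h' => h.2 ((hz v (hCW h.1)).1 h')⟩⟩

/-- No parameter involved depends on `x v`. A set `C` containing `v` occurs in both sums with
opposite signs and cancels; the sets without `v` occur only for the value 1 and form the right-hand
side. -/
theorem marginalPoly_update_add (q : G.ParamIndex → ℝ) {A : Finset V} {v : V} (hv : v ∈ A)
    (hT : ∀ H, G.IsHead H → H ⊆ A → v ∉ G.tail H) (x : V → Fin 2) :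
    G.marginalPoly q A (Function.update x v 0) + G.marginalPoly q A (Function.update x v 1) =
      G.marginalPoly q (A.erase v) x := by
  have hP : ∀ a, ∀ C ⊆ A, G.headProd q (Function.update x v a) C = G.headProd q x C := by
    intro a C hC
    refine headProd_congr q fun H hH hHC w hw => ?_
    refine Function.update_of_ne ?_ _ _
    rintro rfl
    exact hT H hH (hHC.trans hC) hw
  have hz0 : zeros (Function.update x v 0) = insert v (zeros x) := by
    ext w
    by_cases h : w = v <;> simp [mem_zeros, h]
  have hz1 : zeros (Function.update x v 1) = (zeros x).erase v := by
    ext w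
    by_cases h : w = v <;> simp [mem_zeros, h]
  have hA : A.powerset = (insert v (A.erase v)).powerset := by rw [Finset.insert_erase hv]
  have hvA : v ∉ A.erase v := Finset.notMem_erase v A
  simp only [marginalPoly, Finset.sum_filter, hz0, hz1]
  rw [hA, Finset.sum_powerset_insert hvA, Finset.sum_powerset_insert hvA,
    ← Finset.sum_add_distrib, ← Finset.sum_add_distrib, ← Finset.sum_add_distrib]
  refine Finset.sum_congr rfl fun C hC => ?_
  have hCA : C ⊆ A.erase v := Finset.mem_powerset.1 hC
  have hvC : v ∉ C := fun h => hvA (hCA h)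
  have hC1 : C ⊆ A := hCA.trans (Finset.erase_subset v A)
  have hC2 : insert v C ⊆ A := Finset.insert_subset hv hC1
  rw [hP _ C hC1, hP _ C hC1, hP _ _ hC2, hP _ _ hC2]
  have c1 : ¬ insert v (zeros x) ∩ A ⊆ C := fun h =>
    hvC (h (Finset.mem_inter.2 ⟨Finset.mem_insert_self _ _, hv⟩))
  have c2 : insert v (zeros x) ∩ A ⊆ insert v C ↔ zeros x ∩ A.erase v ⊆ C := by
    simp only [Finset.subset_iff, Finset.mem_inter, Finset.mem_insert, Finset.mem_erase]
    grind
  have c3 : (zeros x).erase v ∩ A ⊆ C ↔ zeros x ∩ A.erase v ⊆ C := by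
    simp only [Finset.subset_iff, Finset.mem_inter, Finset.mem_erase]
    grind
  have c4 : (zeros x).erase v ∩ A ⊆ insert v C ↔ zeros x ∩ A.erase v ⊆ C := by
    simp only [Finset.subset_iff, Finset.mem_inter, Finset.mem_insert, Finset.mem_erase]
    grind
  have d1 : insert v C \ insert v (zeros x) = C \ zeros x := by
    ext w
    simp only [Finset.mem_sdiff, Finset.mem_insert]
    grind
  have d2 : C \ (zeros x).erase v = C \ zeros x := by
    ext w
    simp only [Finset.mem_sdiff, Finset.mem_erase]
    grind
  have d3 : insert v C \ (zeros x).erase v = insert v (C \ zeros x) := by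
    ext w
    simp only [Finset.mem_sdiff, Finset.mem_erase, Finset.mem_insert]
    grind
  have d4 : v ∉ C \ zeros x := fun h => hvC (Finset.mem_sdiff.1 h).1
  simp only [c1, c2, c3, c4, d1, d2, d3, Finset.card_insert_of_notMem d4, if_false]
  split_ifs
  · ring
  · ring

theorem mem_Phi_of_subset_an {H : G.Head} {W : Finset V} (hHW : H.1 ⊆ W) (hW : W ⊆ G.an H.1) :
    H ∈ G.Phi W := by
  refine mem_Phi.2 ⟨hHW, fun H' hH' hp => hp.1 (Subtype.ext ?_)⟩
  have h' := hH'.trans hW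
  exact Finset.Subset.antisymm (subset_of_isBarren H.2.2.1 hp.2 h')
    (subset_of_isBarren H'.2.2.1 h' hp.2)

/-- Every `C` in the sum satisfies `H.1 ⊆ C ⊆ G.an H.1`, so `H` is maximal in `C` and its parameter
is a common factor. -/
theorem marginalPoly_an_head (q : G.ParamIndex → ℝ) (H : G.Head) {x : V → Fin 2}
    (hx : ∀ v ∈ H.1, x v = 0) : G.marginalPoly q (G.an H.1) x =
      q ⟨H, fun t => x t⟩ * G.marginalPoly q (G.an H.1 \ H.1) x := by
  have hHA := G.subset_an H.1
  unfold marginalPoly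
  rw [Finset.mul_sum]
  refine Finset.sum_nbij' (fun C => C \ H.1) (fun C => C ∪ H.1) ?_ ?_ ?_ ?_ ?_
  · intro C hC
    simp only [Finset.mem_filter, Finset.mem_powerset, Finset.subset_iff, Finset.mem_inter,
      Finset.mem_sdiff] at hC ⊢
    grind
  · intro C hC
    simp only [Finset.mem_filter, Finset.mem_powerset, Finset.subset_iff, Finset.mem_inter,
      Finset.mem_sdiff, Finset.mem_union] at hC hHA ⊢
    grind
  · intro C hC
    refine Finset.sdiff_union_of_subset fun v hv => (Finset.mem_filter.1 hC).2 ?_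
    exact Finset.mem_inter.2 ⟨mem_zeros.2 (hx v hv), hHA hv⟩
  · intro C hC
    have hCA : C ⊆ G.an H.1 \ H.1 := Finset.mem_powerset.1 (Finset.mem_filter.1 hC).1
    refine Finset.union_sdiff_cancel_right ?_
    exact (Finset.subset_sdiff.1 hCA).2
  · intro C hC
    obtain ⟨hCA, hzC⟩ := Finset.mem_filter.1 hC
    have hHC : H.1 ⊆ C := fun v hv =>
      hzC (Finset.mem_inter.2 ⟨mem_zeros.2 (hx v hv), hHA hv⟩)
    have hPhi := mem_Phi_of_subset_an hHC (Finset.mem_powerset.1 hCA)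
    have hn : H ∉ G.partition (C \ H.1) := fun h => by
      obtain ⟨v, hv⟩ := H.2.1
      exact (Finset.mem_sdiff.1 (subset_of_mem_partition h hv)).2 hv
    have hs : (C \ H.1) \ zeros x = C \ zeros x := by
      ext v
      simp only [Finset.mem_sdiff, mem_zeros]
      grind
    rw [hs, headProd, partition_eq_insert hPhi, Finset.prod_insert hn, headProd]
    ring

theorem marginalPoly_union (q : G.ParamIndex → ℝ) {W₁ W₂ : Finset V} (hd : Disjoint W₁ W₂)
    (hs : ∀ H, G.IsHead H → H ⊆ W₁ ∪ W₂ → H ⊆ W₁ ∨ H ⊆ W₂) (x : V → Fin 2) :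
    G.marginalPoly q (W₁ ∪ W₂) x = G.marginalPoly q W₁ x * G.marginalPoly q W₂ x := by
  unfold marginalPoly
  rw [Finset.sum_mul_sum, ← Finset.sum_product']
  symm
  have hd' := Finset.disjoint_left.1 hd
  refine Finset.sum_nbij' (fun c => c.1 ∪ c.2) (fun C => (C ∩ W₁, C ∩ W₂)) ?_ ?_ ?_ ?_ ?_
  · rintro ⟨C₁, C₂⟩ hC
    simp only [Finset.mem_product, Finset.mem_filter, Finset.mem_powerset, Finset.subset_iff,
      Finset.mem_inter, Finset.mem_union] at hC ⊢
    grind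
  · intro C hC
    simp only [Finset.mem_product, Finset.mem_filter, Finset.mem_powerset, Finset.subset_iff,
      Finset.mem_inter, Finset.mem_union] at hC ⊢
    grind
  · rintro ⟨C₁, C₂⟩ hC
    simp only [Finset.mem_product, Finset.mem_filter, Finset.mem_powerset,
      Finset.subset_iff] at hC
    ext v <;> simp only [Finset.mem_inter, Finset.mem_union] <;> grind
  · intro C hC
    simp only [Finset.mem_filter, Finset.mem_powerset] at hC
    rw [← Finset.inter_union_distrib_left, Finset.inter_eq_left.2 hC.1]
  · rintro ⟨C₁, C₂⟩ hC
    simp only [Finset.mem_product, Finset.mem_filter, Finset.mem_powerset] at hC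
    have hdC : Disjoint C₁ C₂ := Finset.disjoint_of_subset_left hC.1.1
      (Finset.disjoint_of_subset_right hC.2.1 hd)
    have hsC : ∀ H, G.IsHead H → H ⊆ C₁ ∪ C₂ → H ⊆ C₁ ∨ H ⊆ C₂ := by
      intro H hH hHC
      rcases hs H hH (hHC.trans (Finset.union_subset_union hC.1.1 hC.2.1)) with h | h
      · refine .inl fun v hv => (Finset.mem_union.1 (hHC hv)).resolve_right fun h2 => ?_
        exact hd' (h hv) (hC.2.1 h2)
      · refine .inr fun v hv => (Finset.mem_union.1 (hHC hv)).resolve_left fun h2 => ?_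
        exact hd' (hC.1.1 h2) (h hv)
    have hcard : ((C₁ ∪ C₂) \ zeros x).card = (C₁ \ zeros x).card + (C₂ \ zeros x).card := by
      rw [Finset.union_sdiff_distrib, Finset.card_union_of_disjoint]
      exact Finset.disjoint_of_subset_left Finset.sdiff_subset
        (Finset.disjoint_of_subset_right Finset.sdiff_subset hdC)
    simp only [headProd, hcard, partition_union hdC hsC,
      Finset.prod_union (disjoint_partition hdC), pow_add]
    ring

end Polynomial

/-! ### Margins of a function on binary configurations -/

section Probability

set_option linter.unusedSectionVars false

variable {V : Type*} [Fintype V] [DecidableEq V] {p : (V → Fin 2) → ℝ}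

theorem mem_agree {A : Finset V} {x y : V → Fin 2} : y ∈ agree A x ↔ ∀ v ∈ A, y v = x v := Iff.rfl

theorem prob_agree_univ (p : (V → Fin 2) → ℝ) (x : V → Fin 2) :
    prob p (agree Finset.univ x) = p x := by
  have : agree Finset.univ x = {x} := by
    ext y
    simp [mem_agree, funext_iff]
  simp only [prob, this, Set.mem_singleton_iff]
  rw [Finset.filter_eq', if_pos (Finset.mem_univ x), Finset.sum_singleton]

theorem prob_agree_empty (p : (V → Fin 2) → ℝ) (x : V → Fin 2) :
    prob p (agree ∅ x) = ∑ y, p y := by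
  simp [prob, mem_agree]

theorem prob_agree_pos (hp : ∀ x, 0 < p x) (A : Finset V) (x : V → Fin 2) :
    0 < prob p (agree A x) := by
  refine Finset.sum_pos (fun y _ => hp y) ⟨x, ?_⟩
  simp [mem_agree]

theorem prob_agree_update_add (p : (V → Fin 2) → ℝ) {A : Finset V} {v : V} (hv : v ∈ A)
    (x : V → Fin 2) :
    prob p (agree A (Function.update x v 0)) + prob p (agree A (Function.update x v 1)) =
      prob p (agree (A.erase v) x) := by
  classical
  have key : ∀ (a : Fin 2) y, y ∈ agree A (Function.update x v a) ↔
      y ∈ agree (A.erase v) x ∧ y v = a := by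
    intro a y
    simp only [mem_agree, Finset.mem_erase]
    constructor
    · intro h
      exact ⟨fun w hw => by simpa [hw.1] using h w hw.2, by simpa using h v hv⟩
    · intro h w hw
      by_cases hwv : w = v
      · subst hwv; simpa using h.2
      · simpa [hwv] using h.1 w ⟨hwv, hw⟩
  unfold prob
  rw [← Finset.sum_filter_add_sum_filter_not (Finset.univ.filter fun y => y ∈ agree (A.erase v) x)
    (fun y => y v = 0), Finset.filter_filter, Finset.filter_filter]
  congr 1
  · exact Finset.sum_congr (Finset.filter_congr fun y _ => key 0 y) fun _ _ => rfl
  · refine Finset.sum_congr (Finset.filter_congr fun y _ => ?_) fun _ _ => rfl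
    rw [key 1 y]
    have : y v = 1 ↔ ¬ y v = 0 := by omega
    rw [this]

/-- Marginalizing in two steps. -/
theorem prob_agree_eq_sum (p : (V → Fin 2) → ℝ) {S W : Finset V} (hSW : S ⊆ W) (x : V → Fin 2) :
    prob p (agree S x) = prob (fun y => prob p (agree W y)) (agree (S ∪ Wᶜ) x) := by
  classical
  unfold prob
  -- Configurations are grouped by their restriction to `W`. Resetting the other coordinates to
  -- those of `x` picks one representative per group, whence the set `S ∪ Wᶜ`.
  rw [← Finset.sum_fiberwise_of_maps_to (g := fun z => W.piecewise z x)
    (t := Finset.univ.filter fun y => y ∈ agree (S ∪ Wᶜ) x)]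
  · refine Finset.sum_congr rfl fun y hy => Finset.sum_congr ?_ fun _ _ => rfl
    simp only [Finset.mem_filter, Finset.mem_univ, true_and, mem_agree, Finset.mem_union,
      Finset.mem_compl] at hy
    ext z
    simp only [Finset.mem_filter, Finset.mem_univ, true_and, mem_agree, funext_iff,
      Finset.piecewise]
    constructor
    · rintro ⟨-, h⟩ v hv
      simpa [hv] using h v
    · intro h
      refine ⟨fun v hv => (h v (hSW hv)).trans (hy v (.inl hv)), fun v => ?_⟩
      split_ifs with hv
      · exact h v hv
      · exact (hy v (.inr hv)).symm
  · intro z hz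
    simp only [Finset.mem_filter, Finset.mem_univ, true_and, mem_agree, Finset.mem_union,
      Finset.mem_compl, Finset.piecewise] at hz ⊢
    intro v hv
    split_ifs with hvW
    · exact hz v (hv.resolve_right fun h => h hvW)
    · rfl

/-- A function that factorizes is invariant under exchanging the coordinates in `R`, which gives
an exchange identity for its sums. -/
theorem prob_mul_prob_of_swap {m : (V → Fin 2) → ℝ} (R A B C : Finset V) (hA : Disjoint A R)
    (hB : B ⊆ R) (x : V → Fin 2)
    (hm : ∀ y z, y ∈ agree C x → z ∈ agree C x →
      m y * m z = m (R.piecewise z y) * m (R.piecewise y z)) :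
    prob m (agree (A ∪ B ∪ C) x) * prob m (agree C x) =
      prob m (agree (A ∪ C) x) * prob m (agree (B ∪ C) x) := by
  classical
  have hA' := Finset.disjoint_left.1 hA
  unfold prob
  rw [Finset.sum_mul_sum, Finset.sum_mul_sum, ← Finset.sum_product', ← Finset.sum_product']
  -- Exchanging the coordinates in `R` is an involution on pairs. It moves the constraint on `B ⊆ R`
  -- to the other configuration, leaves that on `A` in place, and respects `C`, which both
  -- configurations share.
  refine Finset.sum_nbij' (fun c => (R.piecewise c.2 c.1, R.piecewise c.1 c.2))
    (fun c => (R.piecewise c.2 c.1, R.piecewise c.1 c.2)) ?_ ?_ ?_ ?_ ?_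
  · rintro ⟨y, z⟩ h
    simp only [Finset.mem_product, Finset.mem_filter, Finset.mem_univ, true_and, mem_agree,
      Finset.mem_union, Finset.piecewise] at h ⊢
    grind
  · rintro ⟨y, z⟩ h
    simp only [Finset.mem_product, Finset.mem_filter, Finset.mem_univ, true_and, mem_agree,
      Finset.mem_union, Finset.piecewise] at h ⊢
    grind
  · rintro ⟨y, z⟩ -
    ext v <;> simp only [Finset.piecewise] <;> split_ifs <;> rfl
  · rintro ⟨y, z⟩ -
    ext v <;> simp only [Finset.piecewise] <;> split_ifs <;> rfl
  · rintro ⟨y, z⟩ h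
    simp only [Finset.mem_product, Finset.mem_filter, Finset.mem_univ, true_and, mem_agree,
      Finset.mem_union] at h
    exact hm y z (fun v hv => h.1 v (.inr hv)) h.2

theorem condProb_eq {H T : Finset V} (p : (V → Fin 2) → ℝ) {x : V → Fin 2}
    (hx : ∀ v ∈ H, x v = 0) {t : T → Fin 2} (ht : ∀ v : T, t v = x v) :
    condProb p {y | ∀ v ∈ H, y v = 0} {y | ∀ v : T, y v = t v} =
      prob p (agree (H ∪ T) x) / prob p (agree T x) := by
  have h2 : {y : V → Fin 2 | ∀ v : T, y v = t v} = agree T x := by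
    ext y
    simp only [Set.mem_ofPred_eq, mem_agree, ht, Subtype.forall]
  have h1 : {y : V → Fin 2 | ∀ v ∈ H, y v = 0} ∩ agree T x = agree (H ∪ T) x := by
    ext y
    simp only [Set.mem_inter_iff, Set.mem_ofPred_eq, mem_agree, Finset.mem_union]
    constructor
    · rintro ⟨h, h'⟩ v (hv | hv)
      · rw [h v hv, hx v hv]
      · exact h' v hv
    · intro h
      exact ⟨fun v hv => (h v (.inl hv)).trans (hx v hv), fun v hv => h v (.inr hv)⟩
  rw [condProb, h2, h1]

end Probability

end ADMG

namespace ADMG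

/-! ### From polynomials to the model and back -/

section Model

set_option linter.unusedSectionVars false

variable {V : Type*} [Fintype V] [DecidableEq V] {G : ADMG V}

theorem IsAncestral.sdiff {A B : Finset V} (hA : G.IsAncestral A)
    (hB : ∀ b ∈ B, ∀ w ∈ A, ¬ G.dir b w) : G.IsAncestral (A \ B) := by
  intro u w e hw
  have hwA := (Finset.mem_sdiff.1 hw).1
  exact Finset.mem_sdiff.2 ⟨hA u w e hwA, fun hu => hB u hu w hwA e⟩

theorem IsAncestral.notMem_tail {A H : Finset V} (hA : G.IsAncestral A) {v : V}
    (hv : ∀ w ∈ A, ¬ G.dir v w) (hH : H ⊆ A) : v ∉ G.tail H := fun h => by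
  obtain ⟨w, hw, e⟩ := exists_dir_of_mem_tail h
  exact hv w (hA.an_subset hH hw) e

theorem IsAncestral.exists_insert {A : Finset V} (hA : G.IsAncestral A) (hne : A ≠ Finset.univ) :
    ∃ v ∉ A, G.IsAncestral (insert v A) ∧ ∀ w ∈ insert v A, ¬ G.dir v w := by
  obtain ⟨u, hu⟩ : ∃ u, u ∉ A := by
    by_contra h
    push Not at h
    exact hne (Finset.eq_univ_iff_forall.2 h)
  obtain ⟨v, hv, hmin⟩ := G.wellFounded_transGen.has_min {v | v ∉ A} ⟨u, hu⟩
  refine ⟨v, hv, ?_, ?_⟩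
  · intro a b e hb
    rcases Finset.mem_insert.1 hb with rfl | hb
    · refine Finset.mem_insert_of_mem ?_
      by_contra ha
      exact hmin a ha (.single e)
    · exact Finset.mem_insert_of_mem (hA a b e hb)
  · intro w hw e
    rcases Finset.mem_insert.1 hw with rfl | hw
    · exact G.acyclic _ (.single e)
    · exact hv (hA v w e hw)

theorem tail_subset_of_closed {A D H : Finset V} (hA : G.IsAncestral A) (hDA : D ⊆ A)
    (hD : ∀ d ∈ D, ∀ w ∈ A, G.bi d w → w ∈ D) (hH : H ⊆ D) : G.tail H ⊆ D ∪ G.pa D := by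
  have hdis : G.dis (G.an H) H ⊆ D := fun w hw => by
    obtain ⟨-, v, hv, h⟩ := mem_dis.1 hw
    exact mem_of_reflTransGen_bi (hA.an_subset (hH.trans hDA)) hD (hH hv) h
  refine Finset.union_subset_union (Finset.sdiff_subset.trans hdis) fun w hw => ?_
  obtain ⟨v, hv, e⟩ := mem_pa.1 hw
  exact mem_pa.2 ⟨v, hdis hv, e⟩

theorem closed_sdiff {A D : Finset V} (hD : ∀ d ∈ D, ∀ w ∈ A, G.bi d w → w ∈ D) :
    ∀ d ∈ A \ D, ∀ w ∈ A, G.bi d w → w ∈ A \ D := by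
  intro d hd w hw e
  rw [Finset.mem_sdiff] at hd ⊢
  exact ⟨hw, fun hwD => hd.2 (hD w hwD d hd.1 (G.bi_symm _ _ e))⟩

/-- The polynomials factorize over unions of districts. -/
theorem marginalPoly_union_of_closed (q : G.ParamIndex → ℝ) {A D X : Finset V}
    (hA : G.IsAncestral A) (hDA : D ⊆ A) (hD : ∀ d ∈ D, ∀ w ∈ A, G.bi d w → w ∈ D) (hX : X ⊆ D)
    (x : V → Fin 2) :
    G.marginalPoly q (X ∪ (A \ D)) x = G.marginalPoly q X x * G.marginalPoly q (A \ D) x := by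
  refine marginalPoly_union q ?_ (fun H hH hHs => ?_) x
  · exact Finset.disjoint_of_subset_left hX Finset.disjoint_sdiff
  have hHA : H ⊆ A := hHs.trans (Finset.union_subset (hX.trans hDA) Finset.sdiff_subset)
  by_cases h : ∃ v ∈ H, v ∈ D
  · obtain ⟨v, hv, hvD⟩ := h
    have hHD := hH.subset_of_mem hA hHA hD hv hvD
    refine .inl fun w hw => (Finset.mem_union.1 (hHs hw)).resolve_right fun h => ?_
    exact (Finset.mem_sdiff.1 h).2 (hHD hw)
  · push Not at h
    exact .inr fun w hw => Finset.mem_sdiff.2 ⟨hHA hw, h w hw⟩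

/-- Downward induction from `V`: a minimal vertex outside `A` has no child in the enlarged set,
which is again ancestral, and is summed out. -/
theorem prob_probPoly_agree (q : G.ParamIndex → ℝ) {A : Finset V} (hA : G.IsAncestral A)
    (x : V → Fin 2) :
    prob (fun y => G.probPoly y q) (agree A x) = G.marginalPoly q A x := by
  induction hn : Aᶜ.card using Nat.strong_induction_on generalizing A x with
  | _ n ih =>
    subst hn
    by_cases hne : A = Finset.univ
    · rw [hne, prob_agree_univ, marginalPoly_univ]
    · obtain ⟨v, hv, hins, hch⟩ := hA.exists_insert hne
      have hcard : (insert v A)ᶜ.card < Aᶜ.card := by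
        refine Finset.card_lt_card (Finset.compl_ssubset_compl.2 (Finset.ssubset_insert hv))
      have hvi := Finset.mem_insert_self v A
      rw [← Finset.erase_insert hv, ← prob_agree_update_add _ hvi, ih _ hcard hins _ rfl,
        ih _ hcard hins _ rfl, marginalPoly_update_add q hvi
        fun H _ hH => hins.notMem_tail hch hH]

theorem sum_probPoly (q : G.ParamIndex → ℝ) : ∑ x, G.probPoly x q = 1 := by
  have h := prob_probPoly_agree q (A := ∅) (fun _ _ _ h => absurd h (Finset.notMem_empty _)) 0
  rwa [prob_agree_empty, marginalPoly_empty] at h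

theorem paramOf_probPoly (q : G.ParamIndex → ℝ) (hq : ∀ x, 0 < G.probPoly x q) :
    G.paramOf (fun x => G.probPoly x q) = q := by
  classical
  funext ⟨H, t⟩
  set x : V → Fin 2 := fun v => if h : v ∈ G.tail H.1 then t ⟨v, h⟩ else 0 with hxdef
  have hxt : ∀ v : G.tail H.1, t v = x v := fun v => by simp [hxdef]
  have hdis := disjoint_tail H.2.2.1
  have hxH : ∀ v ∈ H.1, x v = 0 := fun v hv => by
    simp [hxdef, Finset.disjoint_left.1 hdis hv]
  have hA := G.isAncestral_an H.1
  have hHA := G.subset_an H.1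
  have hA' : G.IsAncestral (G.an H.1 \ H.1) :=
    hA.sdiff fun b hb w hw => not_dir_of_isBarren H.2.2.1 hb hw
  have hsub : H.1 ∪ G.tail H.1 ⊆ G.an H.1 := Finset.union_subset hHA tail_subset_an
  have hsub' : G.tail H.1 ⊆ G.an H.1 \ H.1 := Finset.subset_sdiff.2 ⟨tail_subset_an, hdis.symm⟩
  -- The two margins become sums over the same configurations, as in both the coordinates in `H` are
  -- pinned to 0. The terms then differ exactly by the factor `q ⟨H, t⟩`.
  have hset : G.tail H.1 ∪ (G.an H.1 \ H.1)ᶜ = H.1 ∪ G.tail H.1 ∪ (G.an H.1)ᶜ := by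
    ext v
    simp only [Finset.mem_union, Finset.mem_compl, Finset.mem_sdiff]
    tauto
  have hpos := prob_agree_pos hq (G.tail H.1) x
  have key : prob (fun x => G.probPoly x q) (agree (H.1 ∪ G.tail H.1) x) =
      q ⟨H, t⟩ * prob (fun x => G.probPoly x q) (agree (G.tail H.1) x) := by
    rw [prob_agree_eq_sum _ hsub, prob_agree_eq_sum _ hsub', hset]
    unfold prob
    rw [Finset.mul_sum]
    refine Finset.sum_congr rfl fun y hy => ?_
    replace hy := mem_agree.1 (Finset.mem_filter.1 hy).2
    simp only [Finset.mem_union] at hy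
    change prob _ (agree _ y) = _ * prob _ (agree _ y)
    rw [prob_probPoly_agree q hA, prob_probPoly_agree q hA', marginalPoly_an_head q H
      fun v hv => (hy v (.inl (.inl hv))).trans (hxH v hv)]
    congr 3
    funext v
    rw [hxt v, hy v (.inl (.inr v.2))]
  change condProb _ _ _ = _
  rw [condProb_eq _ hxH hxt, key, mul_div_cancel_right₀ _ hpos.ne']

/-- A distribution whose margins on the ancestral sets are given by the polynomials obeys the
global Markov property. -/
theorem globalMarkov_of_marginalPoly {p : (V → Fin 2) → ℝ} (q : G.ParamIndex → ℝ)
    (hp : ∀ A, G.IsAncestral A → ∀ x, prob p (agree A x) = G.marginalPoly q A x) :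
    G.GlobalMarkov p := by
  classical
  intro A B C _ _ _ hAC hBC hsep x
  set W := G.an (A ∪ B ∪ C) with hW
  have hWanc : G.IsAncestral W := G.isAncestral_an _
  have hsubW : A ∪ B ∪ C ⊆ W := G.subset_an _
  -- A walk to `B` from a vertex of `D` can be prolonged by any edge with an arrowhead there, so `D`
  -- is closed under bidirected edges in `W` and its parents are reached. The factor of `D`
  -- therefore involves only `R ∪ C`, and that of `W \ D` avoids `R`.
  set D := W.filter fun v => G.Conn B C v True ∨ (∃ h, G.Conn B C v h) ∧ v ∉ C with hDdef
  set R := W.filter fun v => (∃ h, G.Conn B C v h) ∧ v ∉ C with hRdef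
  have hDW : D ⊆ W := Finset.filter_subset _ _
  have hedge : ∀ v ∈ D, ∀ (w : V) (k : EdgeKind), k.headAtTarget → G.Edge k w v →
      G.Conn B C w k.headAtSource := by
    intro v hv w k hk e
    obtain ⟨hvW, hv⟩ := Finset.mem_filter.1 hv
    refine hsep.conn_of_edge hAC ?_ hv k hk e
    obtain ⟨u, hu, hvu⟩ := mem_an.1 hvW
    simp only [Finset.mem_union] at hu
    rcases hu with (hu | hu) | hu
    · exact .inl ⟨u, hu, hvu⟩
    · exact .inr (.inl ⟨u, hu, hvu⟩)
    · exact .inr (.inr ⟨u, hu, hvu⟩)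
  have hclosed : ∀ d ∈ D, ∀ w ∈ W, G.bi d w → w ∈ D := fun d hd w hw e =>
    Finset.mem_filter.2 ⟨hw, .inl (hedge d hd w .bidir trivial (G.bi_symm _ _ e))⟩
  have hS₁ : ∀ v ∈ D ∪ G.pa D, v ∈ R ∨ v ∈ C := by
    intro v hv
    by_cases hvC : v ∈ C
    · exact .inr hvC
    refine .inl (Finset.mem_filter.2 ?_)
    rcases Finset.mem_union.1 hv with hv | hv
    · obtain ⟨hvW, hv | hv⟩ := Finset.mem_filter.1 hv
      · exact ⟨hvW, ⟨_, hv⟩, hvC⟩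
      · exact ⟨hvW, hv⟩
    · obtain ⟨d, hd, e⟩ := mem_pa.1 hv
      exact ⟨hWanc v d e (hDW hd), ⟨_, hedge d hd v .fwd trivial e⟩, hvC⟩
  have hS₂ : ∀ v ∈ (W \ D) ∪ G.pa (W \ D), v ∉ R := by
    intro v hv hvR
    obtain ⟨hvW, ⟨h, hc⟩, hvC⟩ := Finset.mem_filter.1 hvR
    rcases Finset.mem_union.1 hv with hv | hv
    · exact (Finset.mem_sdiff.1 hv).2 (Finset.mem_filter.2 ⟨hvW, .inr ⟨⟨h, hc⟩, hvC⟩⟩)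
    · obtain ⟨d, hd, e⟩ := mem_pa.1 hv
      obtain ⟨hdW, hdD⟩ := Finset.mem_sdiff.1 hd
      exact hdD (Finset.mem_filter.2 ⟨hdW, .inl (hc.child hvC e)⟩)
  have hfac : ∀ y, prob p (agree W y) = G.marginalPoly q D y * G.marginalPoly q (W \ D) y := by
    intro y
    rw [hp W hWanc, ← marginalPoly_union_of_closed q hWanc hDW hclosed subset_rfl,
      Finset.union_sdiff_of_subset hDW]
  have hcong₁ : ∀ y y', (∀ v ∈ D ∪ G.pa D, y v = y' v) →
      G.marginalPoly q D y = G.marginalPoly q D y' := fun y y' h =>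
    marginalPoly_congr q Finset.subset_union_left
      (fun H _ hH => tail_subset_of_closed hWanc hDW hclosed hH) h
  have hcong₂ : ∀ y y', (∀ v ∈ (W \ D) ∪ G.pa (W \ D), y v = y' v) →
      G.marginalPoly q (W \ D) y = G.marginalPoly q (W \ D) y' := fun y y' h =>
    marginalPoly_congr q Finset.subset_union_left
      (fun H _ hH => tail_subset_of_closed hWanc Finset.sdiff_subset (closed_sdiff hclosed) hH) h
  have hAR : Disjoint A R := Finset.disjoint_left.2 fun a ha haR => by
    obtain ⟨-, ⟨h, hc⟩, -⟩ := Finset.mem_filter.1 haR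
    exact hsep.not_conn hAC ha h hc
  have hBR : B ⊆ R := fun b hb => Finset.mem_filter.2
    ⟨hsubW (by simp [hb]), ⟨_, .base hb⟩, Finset.disjoint_left.1 hBC hb⟩
  have hRC : ∀ v ∈ C, v ∉ R := fun v hv hvR => (Finset.mem_filter.1 hvR).2.2 hv
  have hA : A ⊆ W := fun v hv => hsubW (by simp [hv])
  have hB : B ⊆ W := fun v hv => hsubW (by simp [hv])
  have hC : C ⊆ W := fun v hv => hsubW (by simp [hv])
  rw [prob_agree_eq_sum p hsubW, prob_agree_eq_sum p hC,
    prob_agree_eq_sum p (Finset.union_subset hA hC),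
    prob_agree_eq_sum p (Finset.union_subset hB hC), Finset.union_assoc _ C, Finset.union_assoc A C,
    Finset.union_assoc B C]
  -- Exchanging the coordinates in `R` exchanges the factors of `D` and fixes those of `W \ D`, so
  -- the product of the two margins is unchanged.
  refine prob_mul_prob_of_swap R A B (C ∪ Wᶜ) hAR hBR x fun y z hy hz => ?_
  have hyz : ∀ v ∈ C, y v = z v := fun v hv =>
    (hy v (Finset.mem_union_left _ hv)).trans (hz v (Finset.mem_union_left _ hv)).symm
  have e₁ : ∀ y z : V → Fin 2, (∀ v ∈ C, y v = z v) →
      G.marginalPoly q D (R.piecewise z y) = G.marginalPoly q D z := by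
    intro y z hyz
    refine hcong₁ _ _ fun v hv => ?_
    rcases hS₁ v hv with h | h
    · exact Finset.piecewise_eq_of_mem _ _ _ h
    · rw [Finset.piecewise_eq_of_notMem _ _ _ (hRC v h), hyz v h]
  have e₂ : ∀ y z : V → Fin 2,
      G.marginalPoly q (W \ D) (R.piecewise z y) = G.marginalPoly q (W \ D) y := fun y z =>
    hcong₂ _ _ fun v hv => Finset.piecewise_eq_of_notMem _ _ _ (hS₂ v hv)
  rw [hfac, hfac, hfac, hfac, e₁ y z hyz, e₁ z y fun v hv => (hyz v hv).symm, e₂, e₂]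
  ring

/-- In product form: given the rest of `A`, the law of `X_B` depends only on the rest of `D` and the
parents of `D`. The case where nothing else remains in `A` is separate because the Markov property
concerns non-empty sets. -/
theorem GlobalMarkov.prob_agree_mul {p : (V → Fin 2) → ℝ} (hp : G.GlobalMarkov p)
    {A B D : Finset V} (hA : G.IsAncestral A) (hDA : D ⊆ A)
    (hD : ∀ d ∈ D, ∀ w ∈ A, G.bi d w → w ∈ D) (hne : B.Nonempty) (hBD : B ⊆ D)
    (hB : ∀ b ∈ B, ∀ w ∈ A, ¬ G.dir b w) (x : V → Fin 2) :
    prob p (agree A x) * prob p (agree ((D \ B) ∪ G.pa D) x) =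
      prob p (agree (B ∪ ((D \ B) ∪ G.pa D)) x) * prob p (agree (A \ B) x) := by
  set T := (D \ B) ∪ G.pa D with hT
  have hTA : T ⊆ A := Finset.union_subset (Finset.sdiff_subset.trans hDA) fun w hw => by
    obtain ⟨d, hd, e⟩ := mem_pa.1 hw
    exact hA w d e (hDA hd)
  have hBT : Disjoint B T := by
    refine Finset.disjoint_left.2 fun b hb hbT => ?_
    rcases Finset.mem_union.1 hbT with h | h
    · exact (Finset.mem_sdiff.1 h).2 hb
    · obtain ⟨d, hd, e⟩ := mem_pa.1 h
      exact hB b hb d (hDA hd) e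
  have hBTA : B ∪ T ⊆ A := Finset.union_subset (hBD.trans hDA) hTA
  rcases (A \ (B ∪ T)).eq_empty_or_nonempty with h0 | hE
  · have hAeq : A = B ∪ T := (Finset.sdiff_eq_empty_iff_subset.1 h0).antisymm hBTA
    rw [hAeq, Finset.union_sdiff_cancel_left hBT]
  · have hEB : Disjoint B (A \ (B ∪ T)) :=
      Finset.disjoint_of_subset_left Finset.subset_union_left Finset.disjoint_sdiff
    have hET : Disjoint (A \ (B ∪ T)) T :=
      (Finset.disjoint_of_subset_left Finset.subset_union_right Finset.disjoint_sdiff).symm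
    have hsep : G.MSeparated B (A \ (B ∪ T)) T := by
      refine mSeparated_of_district hA hD hBD hB
        (fun d hd hdB => Finset.mem_union_left _ (Finset.mem_sdiff.2 ⟨hd, hdB⟩))
        (fun d hd w e => Finset.mem_union_right _ (mem_pa.2 ⟨d, hd, e⟩)) hTA Finset.sdiff_subset
        (fun e he heD => ?_) fun e he => Finset.disjoint_left.1 hET he
      obtain ⟨-, he⟩ := Finset.mem_sdiff.1 he
      refine he (Finset.mem_union.2 ?_)
      by_cases heB : e ∈ B
      · exact .inl heB
      · exact .inr (Finset.mem_union_left _ (Finset.mem_sdiff.2 ⟨heD, heB⟩))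
    have h := hp B _ T hne hE hEB hBT hET hsep x
    have h1 : B ∪ A \ (B ∪ T) ∪ T = A := by
      rw [Finset.union_right_comm, Finset.union_sdiff_of_subset hBTA]
    have h2 : A \ (B ∪ T) ∪ T = A \ B := by
      rw [show A \ (B ∪ T) = (A \ B) \ T from sdiff_sdiff_left.symm, Finset.sdiff_union_of_subset]
      exact Finset.subset_sdiff.2 ⟨hTA, hBT.symm⟩
    rwa [h1, h2] at h

theorem paramOf_mul {p : (V → Fin 2) → ℝ} (hpos : ∀ x, 0 < p x) (H : G.Head) {x : V → Fin 2}
    (hx : ∀ v ∈ H.1, x v = 0) : G.paramOf p ⟨H, fun t => x t⟩ * prob p (agree (G.tail H.1) x) =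
      prob p (agree (H.1 ∪ G.tail H.1) x) := by
  have h : G.paramOf p ⟨H, fun t => x t⟩ = _ := condProb_eq p hx fun _ => rfl
  rw [h, div_mul_cancel₀ _ (prob_agree_pos hpos _ x).ne']

/-- Induction on the number of ones in `B`: the value at `x v = 1` is the margin without `v` minus
the value at `x v = 0`, for the probability and the polynomial alike. -/
theorem prob_agree_eq_of_update {p : (V → Fin 2) → ℝ} (q : G.ParamIndex → ℝ) {A B : Finset V}
    (hA : G.IsAncestral A) (hBA : B ⊆ A) (hB : ∀ b ∈ B, ∀ w ∈ A, ¬ G.dir b w)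
    (hzero : ∀ x, (∀ v ∈ B, x v = 0) → prob p (agree A x) = G.marginalPoly q A x)
    (herase : ∀ v ∈ B, ∀ x, prob p (agree (A.erase v) x) = G.marginalPoly q (A.erase v) x)
    (x : V → Fin 2) : prob p (agree A x) = G.marginalPoly q A x := by
  induction hn : (B \ zeros x).card using Nat.strong_induction_on generalizing x with
  | _ n ih =>
    subst hn
    by_cases hx : ∀ v ∈ B, x v = 0
    · exact hzero x hx
    · push Not at hx
      obtain ⟨v, hv, hxv⟩ := hx
      have hup : Function.update x v 1 = x := by
        rw [Function.update_eq_self_iff]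
        omega
      have h1 := prob_agree_update_add p (hBA hv) x
      have h2 := marginalPoly_update_add q (hBA hv)
        (fun H _ hH => hA.notMem_tail (hB v hv) hH) x
      have hlt : (B \ zeros (Function.update x v 0)).card < (B \ zeros x).card := by
        refine Finset.card_lt_card (Finset.ssubset_iff_of_subset ?_ |>.2 ⟨v, ?_, ?_⟩)
        · intro w hw
          rw [Finset.mem_sdiff, mem_zeros] at hw ⊢
          refine ⟨hw.1, fun h => hw.2 ?_⟩
          by_cases hwv : w = v
          · simp [hwv]
          · simpa [hwv] using h
        · simpa [mem_zeros] using ⟨hv, hxv⟩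
        · simp [mem_zeros]
      have h3 := ih _ hlt _ rfl
      rw [hup, herase v hv] at h1
      rw [hup] at h2
      linarith

/-- The margins of a distribution in the model on the ancestral sets are given by the
polynomials. -/
theorem prob_agree_eq_marginalPoly {p : (V → Fin 2) → ℝ} (hp : p ∈ G.model) {A : Finset V}
    (hA : G.IsAncestral A) (x : V → Fin 2) :
    prob p (agree A x) = G.marginalPoly (G.paramOf p) A x := by
  obtain ⟨hpos, hsum, hmar⟩ := hp
  induction hn : A.card using Nat.strong_induction_on generalizing A x with
  | _ n ih =>
    subst hn
    rcases A.eq_empty_or_nonempty with rfl | hne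
    · rw [prob_agree_empty, marginalPoly_empty, hsum]
    have hBA : G.barren A ⊆ A := barren_subset
    have hanB : G.an (G.barren A) = A := (hA.an_subset hBA).antisymm subset_an_barren
    have hB : ∀ b ∈ G.barren A, ∀ w ∈ A, ¬ G.dir b w := fun b hb w hw => by
      rw [← hanB] at hw
      exact not_dir_of_isBarren isBarren_barren hb hw
    have herase : ∀ {A'}, G.IsAncestral A' → A' ⊆ A → ∀ v ∈ A', (∀ w ∈ A, ¬ G.dir v w) → ∀ x,
        prob p (agree (A'.erase v) x) = G.marginalPoly (G.paramOf p) (A'.erase v) x := by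
      intro A' hA' hsub v hv hch x
      exact ih _ ((Finset.card_erase_lt_of_mem hv).trans_le (Finset.card_le_card hsub))
        (hA'.erase fun w hw => hch w (hsub hw)) x rfl
    by_cases hH : G.IsHead (G.barren A)
    · refine prob_agree_eq_of_update _ hA hBA hB (fun x hx => ?_)
        (fun v hv x => herase hA subset_rfl v (hBA hv) (hB v hv) x) x
      have h1 := hmar.prob_agree_mul hA dis_subset (fun d hd w hw e => mem_dis_of_bi hd hw e) hH.1
        (subset_dis hBA) hB x
      have h2 := paramOf_mul hpos ⟨G.barren A, hH⟩ hx
      have h3 := marginalPoly_an_head (G.paramOf p) ⟨G.barren A, hH⟩ hx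
      have h4 : (G.dis A (G.barren A) \ G.barren A) ∪ G.pa (G.dis A (G.barren A)) =
          G.tail (G.barren A) := by rw [tail, hanB]
      rw [h4] at h1
      simp only [hanB] at h3
      rw [h3, ← ih _ (Finset.card_lt_card (Finset.sdiff_ssubset hBA hH.1)) (hA.sdiff hB) x rfl]
      refine mul_right_cancel₀ (prob_agree_pos hpos (G.tail (G.barren A)) x).ne' ?_
      rw [h1, ← h2]
      ring
    · obtain ⟨a, ha⟩ := hne
      obtain ⟨v, hv, -⟩ := mem_an.1 (subset_an_barren ha)
      have hvA := hBA hv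
      set D := G.dis A {v} with hDdef
      have hDA : D ⊆ A := dis_subset
      have hD : ∀ d ∈ D, ∀ w ∈ A, G.bi d w → w ∈ D := fun d hd w hw e => mem_dis_of_bi hd hw e
      have hvD : v ∈ D :=
        subset_dis (Finset.singleton_subset_iff.2 hvA) (Finset.mem_singleton_self v)
      obtain ⟨u, hu, huD⟩ : ∃ u ∈ G.barren A, u ∉ D := by
        by_contra h
        push Not at h
        exact hH ⟨⟨v, hv⟩, isBarren_barren, v, by rwa [hanB], by rwa [hanB]⟩
      have hA' : G.IsAncestral (G.an D) := G.isAncestral_an D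
      have hA'A : G.an D ⊆ A := hA.an_subset hDA
      have hDA' : D ⊆ G.an D := G.subset_an D
      have hD' : ∀ d ∈ D, ∀ w ∈ G.an D, G.bi d w → w ∈ D := fun d hd w hw => hD d hd w (hA'A hw)
      -- The barren vertex `u` lies in another district than `v`, so it is no ancestor of `D`; the
      -- induction hypothesis then applies to `G.an D`.
      have huA' : u ∉ G.an D := fun h => by
        obtain ⟨d, hd, hud⟩ := mem_an.1 h
        exact huD ((mem_barren.1 hu).2 d (hDA hd) hud ▸ hd)
      have hlt : (G.an D).card < A.card :=
        Finset.card_lt_card ((Finset.ssubset_iff_of_subset hA'A).2 ⟨u, hBA hu, huA'⟩)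
      have hv1 : ({v} : Finset V) ⊆ D := Finset.singleton_subset_iff.2 hvD
      have hch : ∀ b ∈ ({v} : Finset V), ∀ w ∈ A, ¬ G.dir b w := fun b hb => by
        rw [Finset.mem_singleton.1 hb]
        exact hB v hv
      -- `D` is closed under bidirected edges both in `A` and in `G.an D`, so `X_v` has the same
      -- conditional law given the rest of either set. Eliminating the common margins gives `key`.
      have m1 := hmar.prob_agree_mul hA hDA hD (Finset.singleton_nonempty v) hv1 hch x
      have m2 := hmar.prob_agree_mul hA' hDA' hD' (Finset.singleton_nonempty v) hv1
        (fun b hb w hw => hch b hb w (hA'A hw)) x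
      rw [Finset.sdiff_singleton_eq_erase v A] at m1
      rw [Finset.sdiff_singleton_eq_erase v (G.an D)] at m2
      have hT := prob_agree_pos hpos ((D \ {v}) ∪ G.pa D) x
      have hE := prob_agree_pos hpos ((G.an D).erase v) x
      have f1 := herase hA subset_rfl v hvA (hB v hv) x
      have f2 := ih _ hlt hA' x rfl
      have f3 := herase hA' hA'A v (hDA' hvD) (hB v hv) x
      have hsplit : ∀ {U : Finset V}, D ⊆ U → U.erase v = D.erase v ∪ (U \ D) := by
        intro U hU
        ext w
        have := @hU w
        simp only [Finset.mem_erase, Finset.mem_union, Finset.mem_sdiff]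
        by_cases hw : w = v
        · subst hw; simp [hvD]
        · by_cases hwD : w ∈ D <;> simp_all
      have g1 := marginalPoly_union_of_closed (G.paramOf p) hA hDA hD (D.erase_subset v) x
      have g2 := marginalPoly_union_of_closed (G.paramOf p) hA hDA hD subset_rfl x
      have g3 := marginalPoly_union_of_closed (G.paramOf p) hA' hDA' hD' (D.erase_subset v) x
      have g4 := marginalPoly_union_of_closed (G.paramOf p) hA' hDA' hD' subset_rfl x
      rw [← hsplit hDA] at g1
      rw [← hsplit hDA'] at g3
      rw [Finset.union_sdiff_of_subset hDA] at g2
      rw [Finset.union_sdiff_of_subset hDA'] at g4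
      have key : prob p (agree A x) * prob p (agree ((G.an D).erase v) x) =
          prob p (agree (G.an D) x) * prob p (agree (A.erase v) x) := by
        refine mul_right_cancel₀ hT.ne' ?_
        linear_combination prob p (agree ((G.an D).erase v) x) * m1 -
          prob p (agree (A.erase v) x) * m2
      -- After factorization over `D`, both sides are the product of the polynomials of `D`,
      -- `D.erase v`, `A \ D` and `G.an D \ D`.
      refine mul_right_cancel₀ hE.ne' ?_
      rw [key, f1, f2, f3, g1, g2, g3, g4]
      ring

end Model

end ADMG

theorem mainTheorem3 {V : Type*} [Fintype V] [DecidableEq V] (G : ADMG V)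
    (q : G.ParamIndex → ℝ) :
    q ∈ G.validParams ↔ ∀ x : V → Fin 2, 0 < G.probPoly x q := by
  constructor
  · rintro ⟨p, hp, rfl⟩ x
    rw [← ADMG.marginalPoly_univ, ← ADMG.prob_agree_eq_marginalPoly hp
      (fun _ _ _ _ => Finset.mem_univ _), ADMG.prob_agree_univ]
    exact hp.1 x
  · intro hq
    exact ⟨fun x => G.probPoly x q, ⟨hq, ADMG.sum_probPoly q,
      ADMG.globalMarkov_of_marginalPoly q fun _ hA => ADMG.prob_probPoly_agree q hA⟩,
      ADMG.paramOf_probPoly q hq⟩
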